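/- Let $k,b,n,c,m$ be positive integers with $k,\,bn,\,cm\ge 2$ and $\gcd(n,m)=1$. Let $$J(k,bn,cm)=\langle s,t,u\mid s^k=t^{bn}=u^{cm}=1,\ stu=tus=ust\rangle,$$ and let the $J$-reflection group $W=W_b^c(k,bn,cm)$ be the normal closure of $\{s,t^n,u^m\}$ in $J(k,bn,cm)$. Write $m=qn+r$ with $q\ge 0$ and $0\le r\le n-1$. Let $\mathcal B_*^*(n,m)$ be the group generated by $x_1,\dots,x_n,y,z$ subject to the relations, where $\delta=x_1\cdots x_ny$, $$x_1\cdots x_n\,y\,z=z\,x_1\cdots x_n\,y,$$ $$x_{i+1}\cdots x_n\,yz\,\delta^{q-1}x_1\cdots x_{i+r}=x_i\cdots x_n\,yz\,\delta^{q-1}x_1\cdots x_{i+r-1}\quad(1\le i\le n-r),$$ $$x_{i+1}\cdots x_n\,yz\,\delta^{q}x_1\cdots x_{i+r-n}=x_i\cdots x_n\,yz\,\delta^{q}x_1\cdots x_{i+r-n-1}\quad(n-r+1\le i\le n).$$ The braid group $\mathcal B(W)$ associated to $W$ is: $\mathcal B_*^*(n,m)$ if $b,c\ge 2$; the group $\mathcal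 B_*(n,m)$ with generators $x_1,\dots,x_n,y$ and the relations obtained by erasing $z$, if $b\ge 2$ and $c=1$; the group $\mathcal B^*(n,m)$ with generators $x_1,\dots,x_n,z$ and the relations obtained by erasing $y$, if $b=1$ and $c\ge 2$; and, if $b=c=1$, the group $$\mathcal B(n,m)=\langle x_1,\dots,x_n\mid x_i\cdots x_{i+m-1}=x_j\cdots x_{j+m-1}\ \ (1\le i<j\le n)\rangle,$$ with indices modulo $n$. For positive integers $p,\ell$, the circular group $G(p,\ell)$ is $\langle a_0,\dots,a_{p-1}\mid a_0\cdots a_{\ell-1}=a_i\cdots a_{i+\ell-1}\ (0\le i<p)\rangle$, with indices modulo $p$. A Garside monoid is a cancellative monoid $M$ such that: there is $\lambda:M\to\mathbb N$ with $\lambda(ab)\ge\lambda(a)+\lambda(b)$ for all $a,b$ and $\lambda^{-1}(0)=\{1\}$; left-divisibility and right-divisibility are both lattice orders on $M$; and there is $\Delta\in M$ whose left-divisors and right-divisors are the same, are finite in number, and generate $M$. A Garside group is a group of fractions of a Garside monoid $M$, that is, a group in which $M$ embeds and each of whose elements has the form $a^{-1}b$ with $a,b\in M$. **Corollary.** For every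 $J$-reflection group $W$, the associated braid group $\mathcal B(W)$ is isomorphic to a circular group and is a Garside group. In particular, it is torsion-free: its only element of finite order is the identity. -/

import Mathlib

/-! ### J-groups and J-reflection groups -/

/-- The relators of `⟨s, t, u ∣ s^k = t^N = u^M = 1, stu = tus = ust⟩`, for three elements
`s, t, u` of a group. -/
def jRelators {G : Type*} [Group G] (k N M : ℕ) (s t u : G) : Set G :=
  {s ^ k, t ^ N, u ^ M, (s * t * u) * (t * u * s)⁻¹, (t * u * s) * (u * s * t)⁻¹}

/-- The group `J(k, N, M)`, with canonical generators `s, t, u` indexed by `0, 1, 2`. -/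
abbrev JGroup (k N M : ℕ) : Type :=
  PresentedGroup (jRelators k N M
    (FreeGroup.of (0 : Fin 3)) (FreeGroup.of (1 : Fin 3)) (FreeGroup.of (2 : Fin 3)))

namespace JGroup

/-- The canonical generator `s` of `J(k, N, M)`. -/
def s (k N M : ℕ) : JGroup k N M := PresentedGroup.of 0

/-- The canonical generator `t` of `J(k, N, M)`. -/
def t (k N M : ℕ) : JGroup k N M := PresentedGroup.of 1

/-- The canonical generator `u` of `J(k, N, M)`. -/
def u (k N M : ℕ) : JGroup k N M := PresentedGroup.of 2

end JGroup

/-- The J-reflection group `W_b^c(k, bn, cm)`, given by its parameters: positive integers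
`k, b, n, c, m` with `k, bn, cm ≥ 2` and `n, m` coprime. (Positivity of `b, n, c, m` follows from
`bn, cm ≥ 2`.) The group itself is `JReflectionGroup.toSubgroup`. -/
structure JReflectionGroup where
  k : ℕ
  b : ℕ
  n : ℕ
  c : ℕ
  m : ℕ
  two_le_k : 2 ≤ k
  two_le_bn : 2 ≤ b * n
  two_le_cm : 2 ≤ c * m
  coprime : Nat.Coprime n m

/-- `W_b^c(k, bn, cm)` is the normal closure of `{s, t^n, u^m}` in `J(k, bn, cm)`. -/
def JReflectionGroup.toSubgroup (W : JReflectionGroup) :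
    Subgroup (JGroup W.k (W.b * W.n) (W.c * W.m)) :=
  Subgroup.normalClosure {JGroup.s _ _ _, JGroup.t _ _ _ ^ W.n, JGroup.u _ _ _ ^ W.m}

/-! ### Braid groups of J-reflection groups -/

section BraidRelators

variable {G : Type*} [Group G]

/-- The product `x_i x_{i+1} ⋯ x_j` of consecutive terms of the sequence `x_1, …, x_n`
(numbered from `1`); it is `1` if `i = j + 1`. -/
def xProd {n : ℕ} (x : Fin n → G) (i j : ℕ) : G :=
  (((List.ofFn x).take j).drop (i - 1)).prod

/-- The relator of `x_1 ⋯ x_n y z = z x_1 ⋯ x_n y`. -/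
def commRelators {n : ℕ} (x : Fin n → G) (y z : G) : Set G :=
  {(xProd x 1 n * y * z) * (z * xProd x 1 n * y)⁻¹}

/-- With `m = q n + r`, `0 ≤ r < n`, and `δ = x_1 ⋯ x_n y`, the relators of
`x_{i+1} ⋯ x_n y z δ^{q-1} x_1 ⋯ x_{i+r} = x_i ⋯ x_n y z δ^{q-1} x_1 ⋯ x_{i+r-1}`
for `1 ≤ i ≤ n - r`, and of
`x_{i+1} ⋯ x_n y z δ^q x_1 ⋯ x_{i+r-n} = x_i ⋯ x_n y z δ^q x_1 ⋯ x_{i+r-n-1}`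
for `n - r + 1 ≤ i ≤ n`. The exponent `q - 1` is an integer, equal to `-1` if `m < n`. -/
def shiftRelators {n : ℕ} (m : ℕ) (x : Fin n → G) (y z : G) : Set G :=
  let q := m / n
  let r := m % n
  let δ := xProd x 1 n * y
  {w | ∃ i : ℕ, 1 ≤ i ∧ i ≤ n - r ∧
    w = (xProd x (i + 1) n * y * z * δ ^ ((q : ℤ) - 1) * xProd x 1 (i + r)) *
      (xProd x i n * y * z * δ ^ ((q : ℤ) - 1) * xProd x 1 (i + r - 1))⁻¹} ∪
  {w | ∃ i : ℕ, n - r + 1 ≤ i ∧ i ≤ n ∧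
    w = (xProd x (i + 1) n * y * z * δ ^ q * xProd x 1 (i + r - n)) *
      (xProd x i n * y * z * δ ^ q * xProd x 1 (i + r - n - 1))⁻¹}

end BraidRelators

/-- The group `B_*^*(n, m)`, generated by `x_1, …, x_n, y, z`. -/
abbrev BraidGroupYZ (n m : ℕ) : Type :=
  let x : Fin n → FreeGroup (Fin n ⊕ Unit ⊕ Unit) := fun i => FreeGroup.of (Sum.inl i)
  let y : FreeGroup (Fin n ⊕ Unit ⊕ Unit) := FreeGroup.of (Sum.inr (Sum.inl ()))
  let z : FreeGroup (Fin n ⊕ Unit ⊕ Unit) := FreeGroup.of (Sum.inr (Sum.inr ()))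
  PresentedGroup (commRelators x y z ∪ shiftRelators m x y z)

/-- The group `B_*(n, m)`, generated by `x_1, …, x_n, y`: the relations are the same with `z`
erased (the first one then becomes empty). -/
abbrev BraidGroupY (n m : ℕ) : Type :=
  let x : Fin n → FreeGroup (Fin n ⊕ Unit) := fun i => FreeGroup.of (Sum.inl i)
  let y : FreeGroup (Fin n ⊕ Unit) := FreeGroup.of (Sum.inr ())
  PresentedGroup (shiftRelators m x y 1)

/-- The group `B^*(n, m)`, generated by `x_1, …, x_n, z`: the relations are the same with `y`
erased. -/
abbrev BraidGroupZ (n m : ℕ) : Type :=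
  let x : Fin n → FreeGroup (Fin n ⊕ Unit) := fun i => FreeGroup.of (Sum.inl i)
  let z : FreeGroup (Fin n ⊕ Unit) := FreeGroup.of (Sum.inr ())
  PresentedGroup (commRelators x 1 z ∪ shiftRelators m x 1 z)

/-- The product `a_i a_{i+1} ⋯ a_{i+l-1}` of `l` consecutive generators, indices modulo `p`, in the
free group on `ℤ/p`. -/
def cyclicWord (p l : ℕ) (i : ZMod p) : FreeGroup (ZMod p) :=
  ((List.range l).map fun j => FreeGroup.of (i + (j : ZMod p))).prod

/-- The group `B(n, m) = ⟨x_1, …, x_n ∣ x_i ⋯ x_{i+m-1} = x_j ⋯ x_{j+m-1}, 1 ≤ i < j ≤ n⟩`,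
indices modulo `n`. -/
abbrev BraidGroupToric (n m : ℕ) : Type :=
  PresentedGroup {w : FreeGroup (ZMod n) | ∃ i j : ℕ, 1 ≤ i ∧ i < j ∧ j ≤ n ∧
    w = cyclicWord n m i * (cyclicWord n m j)⁻¹}

/-- The braid group associated to the J-reflection group `W_b^c(k, bn, cm)`; the definition
distinguishes whether `b` or `c` equals `1`. -/
noncomputable def JReflectionGroup.braidGroup (W : JReflectionGroup) : GrpCat.{0} :=
  if W.b = 1 then
    if W.c = 1 then GrpCat.of (BraidGroupToric W.n W.m) else GrpCat.of (BraidGroupZ W.n W.m)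
  else
    if W.c = 1 then GrpCat.of (BraidGroupY W.n W.m) else GrpCat.of (BraidGroupYZ W.n W.m)

/-! ### Circular groups -/

/-- The circular group
`G(p, l) = ⟨a_0, …, a_{p-1} ∣ a_0 ⋯ a_{l-1} = a_i ⋯ a_{i+l-1} for all i⟩`, indices modulo `p`. -/
abbrev CircularGroup (p l : ℕ) : Type :=
  PresentedGroup {w : FreeGroup (ZMod p) | ∃ i : ZMod p,
    w = cyclicWord p l 0 * (cyclicWord p l i)⁻¹}

/-- A group is circular if it is isomorphic to some `G(p, l)` with `p, l` positive. -/
def IsCircularGroup (G : Type*) [Group G] : Prop :=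
  ∃ p l : ℕ, 1 ≤ p ∧ 1 ≤ l ∧ Nonempty (G ≃* CircularGroup p l)

/-! ### Garside monoids and Garside groups -/

/-- `a` is a left-divisor of `b`. -/
def LeftDivides {M : Type*} [Monoid M] (a b : M) : Prop := ∃ c, a * c = b

/-- `a` is a right-divisor of `b`. -/
def RightDivides {M : Type*} [Monoid M] (a b : M) : Prop := ∃ c, c * a = b

/-- The relation `r` is a partial order for which any two elements have a greatest lower bound and
a least upper bound. -/
structure IsLatticeOrder {M : Type*} (r : M → M → Prop) : Prop where
  refl : ∀ a, r a a
  antisymm : ∀ a b, r a b → r b a → a = b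
  trans : ∀ a b c, r a b → r b c → r a c
  exists_inf : ∀ a b, ∃ d, r d a ∧ r d b ∧ ∀ e, r e a → r e b → r e d
  exists_sup : ∀ a b, ∃ d, r a d ∧ r b d ∧ ∀ e, r a e → r b e → r d e

/-- Garside elements: the left- and right-divisors of `Δ` coincide, generate the monoid, and are
finite in number. -/
structure IsGarsideElement {M : Type*} [Monoid M] (Δ : M) : Prop where
  div_eq : {a : M | LeftDivides a Δ} = {a : M | RightDivides a Δ}
  closure_div : Submonoid.closure {a : M | LeftDivides a Δ} = ⊤
  finite_div : {a : M | LeftDivides a Δ}.Finite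

/-- Garside monoids. -/
structure IsGarsideMonoid (M : Type*) [Monoid M] : Prop where
  noetherian : ∃ lam : M → ℕ, (∀ a b, lam a + lam b ≤ lam (a * b)) ∧ ∀ a, lam a = 0 ↔ a = 1
  left_cancel : ∀ a b c : M, a * b = a * c → b = c
  right_cancel : ∀ a b c : M, b * a = c * a → b = c
  lattice_left : IsLatticeOrder (LeftDivides : M → M → Prop)
  lattice_right : IsLatticeOrder (RightDivides : M → M → Prop)
  exists_garside : ∃ Δ : M, IsGarsideElement Δ

/-- A Garside group is a group of fractions of a Garside monoid: the monoid embeds in it and every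
element is a fraction `a⁻¹ b` of elements of the monoid. -/
def IsGarsideGroup.{u} (G : Type u) [Group G] : Prop :=
  ∃ (M : Type u) (_ : Monoid M), IsGarsideMonoid M ∧
    ∃ ι : M →* G, Function.Injective ι ∧ ∀ g : G, ∃ a b : M, g = (ι a)⁻¹ * ι b

/-!
A circular group `G(p, l)` is the group of fractions of the monoid `M` generated in it by its
atoms `a_i`, and `M` is a Garside monoid. Cancellativity, the length function and the properties of
`Δ = a_0 ⋯ a_{l-1}` come from working inside the group, where all defining relations are homogeneous
and conjugation by `Δ` permutes the atoms. What has to be proved is that divisibility is a lattice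
order, and this reduces to one local fact: if two different atoms left-divide an element of `M`,
then so does `Δ` (`IsGarsideFamily.dvd_of_two`). It is read off from the normal form
`Δ ^ k a_{i_1} ⋯ a_{i_s}` in which no `l` consecutive indices form a run `i, i + 1, …, i + l - 1`:
letting the group act on the set of these normal forms shows that they are unique, and an atom
that divides an element not divisible by `Δ` is the first letter of its normal form
(`CircularGroup.garside_dvd_or_head`). Greatest common divisors then exist by induction on the
length (`IsGarsideFamily.exists_gcd`), the order extends to a lattice order on the group, right
divisibility is handled by the anti-automorphism `a_i ↦ a_{-i}`, and least upper bounds are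
lower bounds of inverses. An element `g` of finite order fixes the infimum of its powers, so
`g = 1` (`HasLeftInf.eq_one_of_isOfFinOrder`).

To identify the braid groups, write `α n + β m = 1`. The relations of `B_*^*(n, m)` say that
`Π = z δ^q x_1 ⋯ x_r` commutes with `y`, and that once `x` is extended to `ℤ` by
`x_{i+n} = y x_i y⁻¹`, the element `Θ = Π y^{-q}` satisfies `Θ⁻¹ x_i Θ = x_{i+m}`. Hence
`T = y^α Θ^{-β}` shifts the sequence by one, `C = y^m Θ^n` is central, and with `w = x_1 T` one gets
`x_{j+1} = T^j w T^{-(j+1)}`, `y = T^n C^β`, `z = C^α w^{-m}`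
(`IsBraidFamily.eq_shiftX`, `IsBraidFamily.eq_y`, `IsBraidFamily.eq_z`); conversely these
formulas always satisfy the relations (`isBraidFamily_shiftX`). So `B_*^*(n, m)` is the product
of the free group on `T, w` and the infinite cyclic group on `C`, which is `G(3, 3)`. Adding `z = 1`
or `y = 1` makes two of the three generators powers of one element, and gives `G(2, 2m)` or
`G(2, 2n)`; and `B(n, m)` is `G(n, m)` by definition, up to redundant relations.
-/

/-! ### Positive cones with greatest lower bounds -/

/-- The submonoid `M` has *left infima* if any two elements of `G` have a greatest lower bound for
the left-invariant relation `g ≤ h ↔ g⁻¹ * h ∈ M`. -/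
def HasLeftInf {G : Type*} [Group G] (M : Submonoid G) : Prop :=
  ∀ g h : G, ∃ d, d⁻¹ * g ∈ M ∧ d⁻¹ * h ∈ M ∧ ∀ e, e⁻¹ * g ∈ M → e⁻¹ * h ∈ M → e⁻¹ * d ∈ M

/-- The submonoid `M` has *right infima* if any two elements of `G` have a greatest lower bound for
the right-invariant relation `g ≤ h ↔ h * g⁻¹ ∈ M`. -/
def HasRightInf {G : Type*} [Group G] (M : Submonoid G) : Prop :=
  ∀ g h : G, ∃ d, g * d⁻¹ ∈ M ∧ h * d⁻¹ ∈ M ∧ ∀ e, g * e⁻¹ ∈ M → h * e⁻¹ ∈ M → d * e⁻¹ ∈ M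

/-- An anti-automorphism preserving the positive cone exchanges the two orders. -/
theorem HasLeftInf.hasRightInf {G : Type*} [Group G] {M : Submonoid G} (h : HasLeftInf M)
    (ρ : G → G) (mul : ∀ a b, ρ (a * b) = ρ b * ρ a) (inv : ∀ a, ρ (ρ a) = a)
    (pos : ∀ a ∈ M, ρ a ∈ M) : HasRightInf M := by
  have one : ρ 1 = 1 := by
    have := mul 1 1
    rw [mul_one] at this
    exact (left_eq_mul.1 this)
  have ρinv : ∀ a, ρ a⁻¹ = (ρ a)⁻¹ := fun a =>
    eq_inv_of_mul_eq_one_left (by rw [← mul, mul_inv_cancel, one])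
  have key : ∀ a b, a * b⁻¹ ∈ M ↔ (ρ b)⁻¹ * ρ a ∈ M := fun a b => by
    have e : ρ (a * b⁻¹) = (ρ b)⁻¹ * ρ a := by rw [mul, ρinv]
    exact ⟨fun hm => e ▸ pos _ hm, fun hm => by rw [← inv (a * b⁻¹), e]; exact pos _ hm⟩
  intro g g'
  obtain ⟨d, h1, h2, h3⟩ := h (ρ g) (ρ g')
  refine ⟨ρ d, ?_, ?_, fun e he he' => ?_⟩
  · rw [key, inv]; exact h1
  · rw [key, inv]; exact h2
  · rw [key, inv]; exact h3 _ ((key _ _).1 he) ((key _ _).1 he')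

/-- A group with a left-invariant order having binary infima is torsion-free: the infimum of the
powers of an element of finite order is fixed by left multiplication by that element. -/
theorem HasLeftInf.eq_one_of_isOfFinOrder {G : Type*} [Group G] {M : Submonoid G}
    (h : HasLeftInf M) (antisymm : ∀ g ∈ M, g⁻¹ ∈ M → g = 1) (g : G) (hg : IsOfFinOrder g) :
    g = 1 := by
  have inf_pow : ∀ k : ℕ, ∃ d : G, (∀ i ≤ k, d⁻¹ * g ^ i ∈ M) ∧
      ∀ e : G, (∀ i ≤ k, e⁻¹ * g ^ i ∈ M) → e⁻¹ * d ∈ M := by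
    intro k
    induction k with
    | zero =>
      exact ⟨1, fun i hi => by simp [Nat.le_zero.1 hi], fun e he => by simpa using he 0 le_rfl⟩
    | succ k ih =>
      obtain ⟨d, hd, hd'⟩ := ih
      obtain ⟨f, h1, h2, h3⟩ := h d (g ^ (k + 1))
      refine ⟨f, fun i hi => ?_, fun e he => h3 e (hd' e fun i hi => he i (by omega)) (he _ le_rfl)⟩
      rcases Nat.of_le_succ hi with hi | rfl
      · have := M.mul_mem h1 (hd i hi)
        rwa [mul_assoc, mul_inv_cancel_left] at this
      · exact h2
  obtain ⟨N, hN, hgN⟩ := isOfFinOrder_iff_pow_eq_one.1 hg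
  obtain ⟨d, hd, hd'⟩ := inf_pow (N - 1)
  have hall : ∀ i : ℕ, d⁻¹ * g ^ i ∈ M := fun i => by
    rw [pow_eq_pow_mod i hgN]
    exact hd _ (by have := Nat.mod_lt i hN; omega)
  have h1 : (g * d)⁻¹ * d ∈ M := hd' _ fun i _ => by
    have e : (g * d)⁻¹ * g ^ i = d⁻¹ * g ^ (i + (N - 1)) := by
      rw [mul_inv_rev, mul_assoc]
      congr 1
      rw [inv_mul_eq_iff_eq_mul, ← pow_succ', show i + (N - 1) + 1 = i + N by omega, pow_add, hgN,
        mul_one]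
    rw [e]
    exact hall _
  have h2 : (g⁻¹ * d)⁻¹ * d ∈ M := hd' _ fun i _ => by
    have e : (g⁻¹ * d)⁻¹ * g ^ i = d⁻¹ * g ^ (i + 1) := by
      rw [mul_inv_rev, inv_inv, mul_assoc, ← pow_succ']
    rw [e]
    exact hall _
  have h3 := antisymm ((g * d)⁻¹ * d) h1 (by convert h2 using 1; group)
  have h4 : d⁻¹ * g⁻¹ * d = 1 := by rw [← h3]; group
  have h5 : g⁻¹ = 1 := by
    have := congrArg (fun t => d * t * d⁻¹) h4
    simpa [mul_assoc] using this
  simpa using h5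

/-! ### Garside structures from atoms -/

/-- Elements `a i` (the atoms) and `Δ` of a group, together with a length homomorphism, such that
`Δ` permutes the atoms by conjugation, is left-divisible by each of them, and left-divides every
positive element that is left-divisible by two different atoms. Positive elements are the products
of atoms, and `len` is the number of factors. -/
structure IsGarsideFamily {G ι : Type*} [Group G] (a : ι → G) (Δ : G)
    (len : G →* Multiplicative ℤ) : Prop where
  len_atom : ∀ i, len (a i) = Multiplicative.ofAdd 1
  atom_dvd : ∀ i, (a i)⁻¹ * Δ ∈ Submonoid.closure (Set.range a)
  conj : ∀ i, ∃ j, a i * Δ = Δ * a j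
  conj_symm : ∀ i, ∃ j, Δ * a i = a j * Δ
  dvd_of_two : ∀ i j, i ≠ j → ∀ g ∈ Submonoid.closure (Set.range a),
    (a i)⁻¹ * g ∈ Submonoid.closure (Set.range a) →
    (a j)⁻¹ * g ∈ Submonoid.closure (Set.range a) → Δ⁻¹ * g ∈ Submonoid.closure (Set.range a)

namespace IsGarsideFamily

variable {G ι : Type*} [Group G] {a : ι → G} {Δ : G} {len : G →* Multiplicative ℤ}

theorem exists_list {g : G} (hg : g ∈ Submonoid.closure (Set.range a)) :
    ∃ L : List ι, (L.map a).prod = g := by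
  induction hg using Submonoid.closure_induction with
  | mem x hx => obtain ⟨i, rfl⟩ := hx; exact ⟨[i], by simp⟩
  | one => exact ⟨[], rfl⟩
  | mul x y _ _ hx hy =>
    obtain ⟨L, rfl⟩ := hx
    obtain ⟨L', rfl⟩ := hy
    exact ⟨L ++ L', by simp⟩

theorem atom_mem (i : ι) : a i ∈ Submonoid.closure (Set.range a) :=
  Submonoid.subset_closure ⟨i, rfl⟩

theorem len_list (h : IsGarsideFamily a Δ len) (L : List ι) :
    (len (L.map a).prod).toAdd = L.length := by
  induction L with
  | nil => simp
  | cons i L ih => simp [h.len_atom, ih, add_comm]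

theorem len_nonneg (h : IsGarsideFamily a Δ len) {g : G}
    (hg : g ∈ Submonoid.closure (Set.range a)) : 0 ≤ (len g).toAdd := by
  obtain ⟨L, rfl⟩ := exists_list hg
  rw [h.len_list]
  positivity

theorem eq_one_of_len (h : IsGarsideFamily a Δ len) {g : G}
    (hg : g ∈ Submonoid.closure (Set.range a)) (h0 : (len g).toAdd = 0) : g = 1 := by
  obtain ⟨L, rfl⟩ := exists_list hg
  rw [h.len_list] at h0
  have : L = [] := List.length_eq_zero_iff.1 (by exact_mod_cast h0)
  simp [this]

theorem antisymm (h : IsGarsideFamily a Δ len) {g : G}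
    (hg : g ∈ Submonoid.closure (Set.range a)) (hg' : g⁻¹ ∈ Submonoid.closure (Set.range a)) :
    g = 1 := by
  refine h.eq_one_of_len hg ?_
  have h1 := h.len_nonneg hg
  have h2 := h.len_nonneg hg'
  rw [map_inv, toAdd_inv] at h2
  omega

theorem eq_one_or_atom_dvd {g : G} (hg : g ∈ Submonoid.closure (Set.range a)) :
    g = 1 ∨ ∃ i, (a i)⁻¹ * g ∈ Submonoid.closure (Set.range a) := by
  obtain ⟨L, rfl⟩ := exists_list hg
  cases L with
  | nil => exact Or.inl rfl
  | cons i L =>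
    refine Or.inr ⟨i, ?_⟩
    rw [List.map_cons, List.prod_cons, inv_mul_cancel_left]
    exact Submonoid.list_prod_mem _ (by
      intro x hx
      obtain ⟨j, _, rfl⟩ := List.mem_map.1 hx
      exact atom_mem j)

theorem garside_mem [Nonempty ι] (h : IsGarsideFamily a Δ len) :
    Δ ∈ Submonoid.closure (Set.range a) := by
  obtain ⟨i⟩ := ‹Nonempty ι›
  simpa using Submonoid.mul_mem _ (atom_mem i) (h.atom_dvd i)

theorem len_garside_pos [Nonempty ι] (h : IsGarsideFamily a Δ len) : 0 < (len Δ).toAdd := by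
  obtain ⟨i⟩ := ‹Nonempty ι›
  have := h.len_nonneg (h.atom_dvd i)
  rw [map_mul, map_inv, toAdd_mul, toAdd_inv, h.len_atom, toAdd_ofAdd] at this
  omega

theorem conj_mem (h : IsGarsideFamily a Δ len) {g : G}
    (hg : g ∈ Submonoid.closure (Set.range a)) :
    Δ⁻¹ * g * Δ ∈ Submonoid.closure (Set.range a) := by
  induction hg using Submonoid.closure_induction with
  | mem x hx =>
    obtain ⟨i, rfl⟩ := hx
    obtain ⟨j, hj⟩ := h.conj i
    rw [mul_assoc, hj, inv_mul_cancel_left]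
    exact atom_mem j
  | one => simp
  | mul x y _ _ hx hy => convert Submonoid.mul_mem _ hx hy using 1; group

theorem conj_symm_mem (h : IsGarsideFamily a Δ len) {g : G}
    (hg : g ∈ Submonoid.closure (Set.range a)) :
    Δ * g * Δ⁻¹ ∈ Submonoid.closure (Set.range a) := by
  induction hg using Submonoid.closure_induction with
  | mem x hx =>
    obtain ⟨i, rfl⟩ := hx
    obtain ⟨j, hj⟩ := h.conj_symm i
    rw [hj, mul_inv_cancel_right]
    exact atom_mem j
  | one => simp
  | mul x y _ _ hx hy => convert Submonoid.mul_mem _ hx hy using 1; group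

/-- Greatest common left-divisors of positive elements, by induction on the length. If two atoms
divide both elements, then so does `Δ`, and it can be factored out; otherwise at most one atom
divides both, and every nontrivial common divisor begins with it. -/
theorem exists_gcd [Nonempty ι] (h : IsGarsideFamily a Δ len) (N : ℕ) :
    ∀ g g' : G, g ∈ Submonoid.closure (Set.range a) → g' ∈ Submonoid.closure (Set.range a) →
      (len g).toAdd ≤ N → ∃ d ∈ Submonoid.closure (Set.range a),
        d⁻¹ * g ∈ Submonoid.closure (Set.range a) ∧ d⁻¹ * g' ∈ Submonoid.closure (Set.range a) ∧
        ∀ e ∈ Submonoid.closure (Set.range a), e⁻¹ * g ∈ Submonoid.closure (Set.range a) →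
          e⁻¹ * g' ∈ Submonoid.closure (Set.range a) →
          e⁻¹ * d ∈ Submonoid.closure (Set.range a) := by
  set M := Submonoid.closure (Set.range a) with hM
  induction N with
  | zero =>
    intro g g' hg hg' hN
    have : g = 1 := h.eq_one_of_len hg (le_antisymm (by exact_mod_cast hN) (h.len_nonneg hg))
    subst this
    exact ⟨1, M.one_mem, by simp, by simpa using hg', fun e _ he _ => he⟩
  | succ N ih =>
    intro g g' hg hg' hN
    have len_lt : ∀ x : G, 0 < (len x).toAdd → (len (x⁻¹ * g)).toAdd ≤ N := fun x hx => by
      rw [map_mul, map_inv, toAdd_mul, toAdd_inv]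
      push_cast at hN
      omega
    have hatom : ∀ i, 0 < (len (a i)).toAdd := fun i => by rw [h.len_atom]; decide
    by_cases hΔ : Δ⁻¹ * g ∈ M ∧ Δ⁻¹ * g' ∈ M
    · obtain ⟨d, hd, hdg, hdg', hmax⟩ := ih _ _ hΔ.1 hΔ.2 (len_lt _ h.len_garside_pos)
      refine ⟨Δ * d, M.mul_mem h.garside_mem hd, by convert hdg using 1; group,
        by convert hdg' using 1; group, fun e he heg heg' => ?_⟩
      rcases eq_one_or_atom_dvd he with rfl | ⟨i, hi⟩
      · simpa using M.mul_mem h.garside_mem hd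
      have hig : (a i)⁻¹ * g ∈ M := by convert M.mul_mem hi heg using 1; group
      have hig' : (a i)⁻¹ * g' ∈ M := by convert M.mul_mem hi heg' using 1; group
      obtain ⟨f, hf, hfg, hfg', hfmax⟩ := ih _ _ hig hig' (len_lt _ (hatom i))
      -- `f` is a multiple of both `(a i)⁻¹ * e` and `(a i)⁻¹ * Δ`
      have h1 := hfmax _ hi (by convert heg using 1; group) (by convert heg' using 1; group)
      have h2 := hfmax _ (h.atom_dvd i) (by convert hΔ.1 using 1; group)
        (by convert hΔ.2 using 1; group)
      have h3 := hmax _ h2 (by convert hfg using 1; group) (by convert hfg' using 1; group)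
      convert M.mul_mem h1 h3 using 1
      group
    · by_cases hcommon : ∃ i, (a i)⁻¹ * g ∈ M ∧ (a i)⁻¹ * g' ∈ M
      · obtain ⟨i, hig, hig'⟩ := hcommon
        obtain ⟨d, hd, hdg, hdg', hmax⟩ := ih _ _ hig hig' (len_lt _ (hatom i))
        refine ⟨a i * d, M.mul_mem (atom_mem i) hd, by convert hdg using 1; group,
          by convert hdg' using 1; group, fun e he heg heg' => ?_⟩
        rcases eq_one_or_atom_dvd he with rfl | ⟨j, hj⟩
        · simpa using M.mul_mem (atom_mem i) hd
        have hjg : (a j)⁻¹ * g ∈ M := by convert M.mul_mem hj heg using 1; group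
        have hjg' : (a j)⁻¹ * g' ∈ M := by convert M.mul_mem hj heg' using 1; group
        have hij : i = j := by
          by_contra hne
          exact hΔ ⟨h.dvd_of_two i j hne g hg hig hjg, h.dvd_of_two i j hne g' hg' hig' hjg'⟩
        subst hij
        have := hmax _ hj (by convert heg using 1; group) (by convert heg' using 1; group)
        convert this using 1
        group
      · refine ⟨1, M.one_mem, by simpa using hg, by simpa using hg', fun e he heg heg' => ?_⟩
        rcases eq_one_or_atom_dvd he with rfl | ⟨j, hj⟩
        · simp
        · exact absurd ⟨j, by convert M.mul_mem hj heg using 1; group,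
            by convert M.mul_mem hj heg' using 1; group⟩ hcommon

theorem exists_garside_pow_mul_mem [Nonempty ι] (h : IsGarsideFamily a Δ len)
    (hgen : Subgroup.closure (Set.range a) = ⊤) (g : G) :
    ∃ N : ℕ, Δ ^ N * g ∈ Submonoid.closure (Set.range a) := by
  have hg : g ∈ Subgroup.closure (Set.range a) := hgen ▸ Subgroup.mem_top g
  have conj_pow : ∀ (N : ℕ) (x : G), x ∈ Submonoid.closure (Set.range a) →
      Δ ^ N * x * (Δ ^ N)⁻¹ ∈ Submonoid.closure (Set.range a) := by
    intro N x hx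
    induction N with
    | zero => simpa using hx
    | succ N ih => convert h.conj_symm_mem ih using 1; rw [pow_succ']; group
  induction hg using Subgroup.closure_induction'' with
  | one => exact ⟨0, by simp⟩
  | mem x hx => exact ⟨0, by simpa using Submonoid.subset_closure hx⟩
  | inv_mem x hx =>
    obtain ⟨i, rfl⟩ := hx
    refine ⟨1, ?_⟩
    have := h.conj_symm_mem (h.atom_dvd i)
    convert this using 1
    group
  | mul x y _ _ hx hy =>
    obtain ⟨N, hN⟩ := hx
    obtain ⟨K, hK⟩ := hy
    refine ⟨K + N, ?_⟩
    convert Submonoid.mul_mem _ (conj_pow K _ hN) hK using 1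
    rw [pow_add]
    group

/-- Greatest lower bounds in the whole group: `Δ` is used to move to positive elements, and
factoring out a power of `Δ` commutes with taking greatest common divisors. -/
theorem hasLeftInf [Nonempty ι] (h : IsGarsideFamily a Δ len)
    (hgen : Subgroup.closure (Set.range a) = ⊤) :
    HasLeftInf (Submonoid.closure (Set.range a)) := by
  set M := Submonoid.closure (Set.range a) with hM
  have mono : ∀ {K N : ℕ} {g : G}, K ≤ N → Δ ^ K * g ∈ M → Δ ^ N * g ∈ M := fun hKN hg => by
    obtain ⟨t, rfl⟩ := Nat.exists_eq_add_of_le' hKN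
    rw [pow_add, mul_assoc]
    exact M.mul_mem (M.pow_mem h.garside_mem t) hg
  intro g g'
  obtain ⟨N₁, h₁⟩ := h.exists_garside_pow_mul_mem hgen g
  obtain ⟨N₂, h₂⟩ := h.exists_garside_pow_mul_mem hgen g'
  set N := max N₁ N₂
  replace h₁ : Δ ^ N * g ∈ M := mono (le_max_left _ _) h₁
  replace h₂ : Δ ^ N * g' ∈ M := mono (le_max_right _ _) h₂
  obtain ⟨d, hd, hdg, hdg', hmax⟩ :=
    h.exists_gcd (len (Δ ^ N * g)).toAdd.toNat _ _ h₁ h₂ (Int.self_le_toNat _)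
  refine ⟨(Δ ^ N)⁻¹ * d, by convert hdg using 1; group, by convert hdg' using 1; group,
    fun e heg heg' => ?_⟩
  obtain ⟨K, hK⟩ := h.exists_garside_pow_mul_mem hgen e
  have hKe : Δ ^ (K + N) * e ∈ M := mono (Nat.le_add_right _ _) hK
  have hΔK : Δ ^ K ∈ M := M.pow_mem h.garside_mem K
  obtain ⟨f, hf, hfg, hfg', hfmax⟩ := h.exists_gcd (len (Δ ^ (K + N) * g)).toAdd.toNat
    (Δ ^ (K + N) * g) (Δ ^ (K + N) * g')
    (by rw [pow_add, mul_assoc]; exact M.mul_mem hΔK h₁)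
    (by rw [pow_add, mul_assoc]; exact M.mul_mem hΔK h₂) (Int.self_le_toNat _)
  have h3 := hfmax _ hKe (by convert heg using 1; group) (by convert heg' using 1; group)
  have h4 := hfmax _ hΔK (by rw [pow_add, mul_assoc, inv_mul_cancel_left]; exact h₁)
    (by rw [pow_add, mul_assoc, inv_mul_cancel_left]; exact h₂)
  have h5 := hmax _ h4 (by rw [pow_add] at hfg; convert hfg using 1; group)
    (by rw [pow_add] at hfg'; convert hfg' using 1; group)
  convert M.mul_mem h3 h5 using 1
  rw [pow_add]
  group

section Monoid

theorem leftDivides_iff {M : Submonoid G} (x y : M) :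
    LeftDivides x y ↔ (x : G)⁻¹ * y ∈ M := by
  constructor
  · rintro ⟨c, rfl⟩
    simp
  · intro hm
    exact ⟨⟨_, hm⟩, Subtype.ext (by simp)⟩

theorem rightDivides_iff {M : Submonoid G} (x y : M) :
    RightDivides x y ↔ (y : G) * (x : G)⁻¹ ∈ M := by
  constructor
  · rintro ⟨c, rfl⟩
    simp
  · intro hm
    exact ⟨⟨_, hm⟩, Subtype.ext (by simp)⟩

/-- Left-divisibility is a lattice order; its suprema are right infima of inverses. -/
theorem isLatticeOrder_left (h : IsGarsideFamily a Δ len)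
    (hl : HasLeftInf (Submonoid.closure (Set.range a)))
    (hr : HasRightInf (Submonoid.closure (Set.range a))) :
    IsLatticeOrder (LeftDivides : Submonoid.closure (Set.range a) → _ → Prop) where
  refl x := ⟨1, mul_one x⟩
  antisymm x y hxy hyx := by
    rw [leftDivides_iff] at hxy hyx
    have := h.antisymm hxy (by simpa using hyx)
    exact Subtype.ext (inv_mul_eq_one.1 this)
  trans x y z hxy hyz := by
    obtain ⟨c, rfl⟩ := hxy
    obtain ⟨d, rfl⟩ := hyz
    exact ⟨c * d, (mul_assoc _ _ _).symm⟩
  exists_inf x y := by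
    obtain ⟨d, h1, h2, h3⟩ := hl x y
    have hd : d ∈ Submonoid.closure (Set.range a) := by
      simpa using h3 1 (by simp) (by simp)
    refine ⟨⟨d, hd⟩, ?_, ?_, fun e => ?_⟩ <;> simp only [leftDivides_iff]
    exacts [h1, h2, h3 e]
  exists_sup x y := by
    obtain ⟨d, h1, h2, h3⟩ := hr (x : G)⁻¹ (y : G)⁻¹
    have hd : d⁻¹ ∈ Submonoid.closure (Set.range a) := by
      simpa using Submonoid.mul_mem _ x.2 h1
    refine ⟨⟨d⁻¹, hd⟩, ?_, ?_, fun e => ?_⟩ <;> simp only [leftDivides_iff]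
    · exact h1
    · exact h2
    · intro hx hy
      simpa using h3 (e : G)⁻¹ (by simpa using hx) (by simpa using hy)

theorem isLatticeOrder_right (h : IsGarsideFamily a Δ len)
    (hl : HasLeftInf (Submonoid.closure (Set.range a)))
    (hr : HasRightInf (Submonoid.closure (Set.range a))) :
    IsLatticeOrder (RightDivides : Submonoid.closure (Set.range a) → _ → Prop) where
  refl x := ⟨1, one_mul x⟩
  antisymm x y hxy hyx := by
    rw [rightDivides_iff] at hxy hyx
    have := h.antisymm hxy (by simpa using hyx)
    exact Subtype.ext (mul_inv_eq_one.1 this).symm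
  trans x y z hxy hyz := by
    obtain ⟨c, rfl⟩ := hxy
    obtain ⟨d, rfl⟩ := hyz
    exact ⟨d * c, mul_assoc _ _ _⟩
  exists_inf x y := by
    obtain ⟨d, h1, h2, h3⟩ := hr x y
    have hd : d ∈ Submonoid.closure (Set.range a) := by
      simpa using h3 1 (by simp) (by simp)
    refine ⟨⟨d, hd⟩, ?_, ?_, fun e => ?_⟩ <;> simp only [rightDivides_iff]
    exacts [h1, h2, h3 e]
  exists_sup x y := by
    obtain ⟨d, h1, h2, h3⟩ := hl (x : G)⁻¹ (y : G)⁻¹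
    have hd : d⁻¹ ∈ Submonoid.closure (Set.range a) := by
      simpa using Submonoid.mul_mem _ h1 x.2
    refine ⟨⟨d⁻¹, hd⟩, ?_, ?_, fun e => ?_⟩ <;> simp only [rightDivides_iff]
    · exact h1
    · exact h2
    · intro hx hy
      simpa using h3 (e : G)⁻¹ (by simpa using hx) (by simpa using hy)

theorem isGarsideElement [Nonempty ι] [Finite ι] (h : IsGarsideFamily a Δ len) :
    IsGarsideElement (⟨Δ, h.garside_mem⟩ : Submonoid.closure (Set.range a)) where
  div_eq := by
    ext x
    simp only [Set.mem_ofPred_eq, leftDivides_iff, rightDivides_iff]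
    constructor
    · intro hx
      convert h.conj_symm_mem hx using 1
      group
    · intro hx
      convert h.conj_mem hx using 1
      group
  closure_div := by
    rw [eq_top_iff]
    rintro ⟨x, hx⟩ -
    induction hx using Submonoid.closure_induction with
    | mem x hx =>
      obtain ⟨i, rfl⟩ := hx
      exact Submonoid.subset_closure ((leftDivides_iff _ _).2 (h.atom_dvd i))
    | one => exact Submonoid.one_mem _
    | mul x y hx hy ihx ihy => exact Submonoid.mul_mem _ ihx ihy
  finite_div := by
    -- a divisor of `Δ` is a product of at most `len Δ` atoms
    have hfin : ((fun L : List ι => (L.map a).prod) ''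
        {L : List ι | L.length ≤ (len Δ).toAdd.toNat}).Finite :=
      (List.finite_length_le ι _).image _
    refine Set.Finite.of_finite_image (f := Subtype.val) (hfin.subset ?_)
      Subtype.val_injective.injOn
    rintro _ ⟨⟨x, hx⟩, hdiv, rfl⟩
    obtain ⟨L, rfl⟩ := exists_list hx
    have hn := h.len_nonneg ((leftDivides_iff _ _).1 hdiv)
    simp only [map_mul, map_inv, toAdd_mul, toAdd_inv] at hn
    rw [h.len_list] at hn
    exact ⟨L, by simp only [Set.mem_ofPred_eq]; omega, rfl⟩

theorem isGarsideMonoid [Nonempty ι] [Finite ι] (h : IsGarsideFamily a Δ len)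
    (hl : HasLeftInf (Submonoid.closure (Set.range a)))
    (hr : HasRightInf (Submonoid.closure (Set.range a))) :
    IsGarsideMonoid (Submonoid.closure (Set.range a)) where
  noetherian := by
    refine ⟨fun x => (len x).toAdd.toNat, fun x y => ?_, fun x => ⟨fun hx => ?_, ?_⟩⟩
    · have hx := h.len_nonneg x.2
      have hy := h.len_nonneg y.2
      simp only [Submonoid.coe_mul, map_mul, toAdd_mul]
      omega
    · have hx' := h.len_nonneg x.2
      have hx0 : (len x).toAdd.toNat = 0 := hx
      exact Subtype.ext (h.eq_one_of_len x.2 (by omega))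
    · rintro rfl
      simp
  left_cancel x y z hxy := mul_left_cancel hxy
  right_cancel x y z hxy := mul_right_cancel hxy
  lattice_left := h.isLatticeOrder_left hl hr
  lattice_right := h.isLatticeOrder_right hl hr
  exists_garside := ⟨_, h.isGarsideElement⟩

end Monoid

end IsGarsideFamily

theorem IsGarsideFamily.isGarsideGroup.{u} {G : Type u} {ι : Type*} [Group G] {a : ι → G} {Δ : G}
    {len : G →* Multiplicative ℤ} [Nonempty ι] [Finite ι] (h : IsGarsideFamily a Δ len)
    (hgen : Subgroup.closure (Set.range a) = ⊤)
    (hr : HasRightInf (Submonoid.closure (Set.range a))) : IsGarsideGroup G := by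
  refine ⟨Submonoid.closure (Set.range a), inferInstance,
    h.isGarsideMonoid (h.hasLeftInf hgen) hr, (Submonoid.closure (Set.range a)).subtype,
    Subtype.val_injective, fun g => ?_⟩
  obtain ⟨N, hN⟩ := h.exists_garside_pow_mul_mem hgen g
  exact ⟨⟨Δ ^ N, Submonoid.pow_mem _ h.garside_mem N⟩, ⟨_, hN⟩, by simp⟩

theorem IsGarsideGroup.of_mulEquiv.{u} {G H : Type u} [Group G] [Group H] (e : G ≃* H)
    (h : IsGarsideGroup H) : IsGarsideGroup G := by
  obtain ⟨M, _, hM, ι, hι, hfrac⟩ := h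
  refine ⟨M, _, hM, e.symm.toMonoidHom.comp ι, e.symm.injective.comp hι, fun g => ?_⟩
  obtain ⟨x, y, hxy⟩ := hfrac (e g)
  refine ⟨x, y, e.injective ?_⟩
  simpa using hxy

/-! ### Runs of consecutive residues -/

/-- The list `i, i + 1, …, i + t - 1` of residues modulo `p`. -/
def run {p : ℕ} (i : ZMod p) : ℕ → List (ZMod p)
  | 0 => []
  | t + 1 => i :: run (i + 1) t

@[simp] theorem length_run {p : ℕ} (i : ZMod p) (t : ℕ) : (run i t).length = t := by
  induction t generalizing i with
  | zero => rfl
  | succ t ih => simp [run, ih]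

theorem run_add {p : ℕ} (i : ZMod p) (s t : ℕ) :
    run i (s + t) = run i s ++ run (i + (s : ZMod p)) t := by
  induction s generalizing i with
  | zero => simp [run]
  | succ s ih =>
    rw [Nat.succ_add_eq_add_succ, ← Nat.succ_eq_add_one, Nat.add_succ]
    simp only [run, ih, List.cons_append]
    push_cast
    rw [add_assoc i, add_comm 1 (s : ZMod p)]

theorem run_eq_map_range {p : ℕ} (i : ZMod p) (t : ℕ) :
    run i t = (List.range t).map fun j : ℕ => i + (j : ZMod p) := by
  induction t with
  | zero => rfl
  | succ t ih => rw [run_add, ih, List.range_succ, List.map_append]; rfl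

theorem cyclicWord_eq {p : ℕ} (l : ℕ) (i : ZMod p) :
    cyclicWord p l i = ((run i l).map FreeGroup.of).prod := by
  have h : (List.range l).flatMap (fun a : ℕ => [(a : ZMod p)]) =
      (List.range l).map fun a : ℕ => (a : ZMod p) := (List.map_eq_flatMap ..).symm
  simp [run_eq_map_range, cyclicWord, h, Function.comp_def]

/-- A run of length `l` at the start of `run i t ++ L`, with `t < l`, spills over into `L`. -/
theorem run_prefix_append {p : ℕ} {i : ZMod p} {t l : ℕ} {L : List (ZMod p)} (htl : t < l)
    (h : run i l <+: run i t ++ L) : L.head? = some (i + (t : ZMod p)) := by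
  obtain ⟨s, rfl⟩ := Nat.exists_eq_add_of_lt htl
  rw [add_assoc, run_add, List.prefix_append_right_inj] at h
  obtain ⟨L', rfl⟩ := h
  rfl

/-- Every list splits as a maximal run starting at `j`, followed by a remainder. -/
theorem exists_run_append {p : ℕ} (j : ZMod p) (L : List (ZMod p)) :
    ∃ (s : ℕ) (L' : List (ZMod p)), L = run j s ++ L' ∧ L'.head? ≠ some (j + (s : ZMod p)) := by
  induction L generalizing j with
  | nil => exact ⟨0, [], rfl, by simp⟩
  | cons i L ih =>
    by_cases hij : i = j
    · subst hij
      obtain ⟨s, L', rfl, h⟩ := ih (i + 1)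
      refine ⟨s + 1, L', rfl, ?_⟩
      push_cast
      rwa [add_comm (s : ZMod p), ← add_assoc]
    · exact ⟨0, i :: L, rfl, by simpa using hij⟩

/-! ### Normal forms in circular groups -/

namespace CircularGroup

/-- A list of residues is reduced if it contains no run of length `l`. The pair `(k, L)` with `L`
reduced stands for the normal form `Δ ^ k * a_{L₀} * a_{L₁} ⋯`. -/
def Reduced {p : ℕ} (l : ℕ) : List (ZMod p) → Prop
  | [] => True
  | i :: L => ¬ run i l <+: i :: L ∧ Reduced l L

variable {p l : ℕ}

theorem Reduced.append_right {L L' : List (ZMod p)} (h : Reduced l (L ++ L')) : Reduced l L' := by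
  induction L with
  | nil => exact h
  | cons i L ih => exact ih h.2

theorem Reduced.run_append {j : ZMod p} {t : ℕ} {L : List (ZMod p)} (hL : Reduced l L)
    (htl : t < l) (hhead : L.head? ≠ some (j + (t : ZMod p))) : Reduced l (run j t ++ L) := by
  induction t generalizing j with
  | zero => exact hL
  | succ t ih =>
    refine ⟨fun h => hhead (run_prefix_append htl h), ih (by omega) ?_⟩
    rwa [show j + 1 + (t : ZMod p) = j + ((t + 1 : ℕ) : ZMod p) by push_cast; ring]

open Classical in
/-- Left multiplication of a normal form by the atom `a_i`. Moving `a_i` past `Δ ^ k` turns it into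
`a_{i + k l}`; if this completes a run of length `l`, the run is replaced by `Δ`. -/
noncomputable def act (l : ℕ) (i : ZMod p) (x : ℤ × List (ZMod p)) : ℤ × List (ZMod p) :=
  if run (i + (x.1 : ZMod p) * (l : ZMod p)) l <+: (i + (x.1 : ZMod p) * (l : ZMod p)) :: x.2 then
    (x.1 + 1, x.2.drop (l - 1))
  else (x.1, (i + (x.1 : ZMod p) * (l : ZMod p)) :: x.2)

theorem act_of_not {i : ZMod p} {k : ℤ} {L : List (ZMod p)}
    (h : Reduced l ((i + (k : ZMod p) * (l : ZMod p)) :: L)) :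
    act l i (k, L) = (k, (i + (k : ZMod p) * (l : ZMod p)) :: L) :=
  if_neg h.1

theorem act_run {i : ZMod p} {k : ℤ} {L : List (ZMod p)} (hl : 1 ≤ l) :
    act l i (k, run (i + (k : ZMod p) * (l : ZMod p) + 1) (l - 1) ++ L) = (k + 1, L) := by
  obtain ⟨t, rfl⟩ := Nat.exists_eq_add_of_le' hl
  unfold act
  rw [if_pos]
  · simp
  · exact ⟨L, rfl⟩

theorem act_cases (hl : 1 ≤ l) (i : ZMod p) (k : ℤ) (L : List (ZMod p)) (hL : Reduced l L) :
    (act l i (k, L) = (k, (i + (k : ZMod p) * (l : ZMod p)) :: L) ∧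
      Reduced l ((i + (k : ZMod p) * (l : ZMod p)) :: L)) ∨
    ∃ L', L = run (i + (k : ZMod p) * (l : ZMod p) + 1) (l - 1) ++ L' ∧
      act l i (k, L) = (k + 1, L') := by
  by_cases h : run (i + (k : ZMod p) * (l : ZMod p)) l <+: (i + (k : ZMod p) * (l : ZMod p)) :: L
  · right
    obtain ⟨L', hL'⟩ := h
    have e : run (i + (k : ZMod p) * (l : ZMod p)) l =
        (i + (k : ZMod p) * (l : ZMod p)) :: run (i + (k : ZMod p) * (l : ZMod p) + 1) (l - 1) := by
      obtain ⟨t, rfl⟩ := Nat.exists_eq_add_of_le' hl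
      rfl
    rw [e, List.cons_append, List.cons_inj_right] at hL'
    exact ⟨L', hL'.symm, by rw [← hL', act_run hl]⟩
  · exact Or.inl ⟨if_neg h, h, hL⟩

theorem reduced_act (hl : 1 ≤ l) (i : ZMod p) (x : ℤ × List (ZMod p)) (hx : Reduced l x.2) :
    Reduced l (act l i x).2 := by
  obtain ⟨k, L⟩ := x
  rcases act_cases hl i k L hx with ⟨h, h'⟩ | ⟨L', rfl, h⟩
  · rw [h]; exact h'
  · rw [h]; exact Reduced.append_right hx

/-- Successive left multiplication by the atoms of a list, the last one first. -/
noncomputable def actList (l : ℕ) (w : List (ZMod p)) (x : ℤ × List (ZMod p)) :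
    ℤ × List (ZMod p) :=
  w.foldr (act l) x

theorem actList_append (w w' : List (ZMod p)) (x : ℤ × List (ZMod p)) :
    actList l (w ++ w') x = actList l w (actList l w' x) :=
  List.foldr_append

theorem actList_run_of_reduced (t : ℕ) (i : ZMod p) (k : ℤ) (L : List (ZMod p))
    (h : Reduced l (run (i + (k : ZMod p) * (l : ZMod p)) t ++ L)) :
    actList l (run i t) (k, L) = (k, run (i + (k : ZMod p) * (l : ZMod p)) t ++ L) := by
  induction t generalizing i with
  | zero => rfl
  | succ t ih =>
    have e : i + (k : ZMod p) * (l : ZMod p) + 1 = i + 1 + (k : ZMod p) * (l : ZMod p) := by ring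
    have h' : Reduced l ((i + (k : ZMod p) * (l : ZMod p)) ::
        (run (i + 1 + (k : ZMod p) * (l : ZMod p)) t ++ L)) := by
      rw [← e]; exact h
    change act l i (actList l (run (i + 1) t) (k, L)) = _
    rw [ih (i + 1) h'.2, act_of_not h', ← e]
    rfl

/-- Multiplying a normal form by a run of length `l` multiplies it by `Δ`: the run first meets the
maximal run with which the normal form continues it, and what is left over after the
completion of `Δ` restores that maximal run. -/
theorem actList_run (i : ZMod p) (x : ℤ × List (ZMod p)) (hx : Reduced l x.2) (hl : 1 ≤ l) :
    actList l (run i l) x = (x.1 + 1, x.2) := by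
  obtain ⟨k, L⟩ := x
  obtain ⟨s, L', rfl, hhead⟩ := exists_run_append (i + (l : ZMod p) + (k : ZMod p) * (l : ZMod p)) L
  have hs : s < l := by
    by_contra hs
    obtain ⟨u, rfl⟩ := Nat.exists_eq_add_of_le (not_lt.1 hs)
    obtain ⟨t, rfl⟩ := Nat.exists_eq_add_of_le' hl
    rw [run_add, List.append_assoc] at hx
    exact hx.1 ⟨_, rfl⟩
  have hL' : Reduced l L' := Reduced.append_right hx
  have hsplit : run i l =
      run i s ++ (i + (s : ZMod p)) :: run (i + (s : ZMod p) + 1) (l - 1 - s) := by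
    obtain ⟨u, rfl⟩ := Nat.exists_eq_add_of_lt hs
    rw [show s + u + 1 = s + (u + 1) by ring, run_add, show s + (u + 1) - 1 - s = u by omega]
    rfl
  have hjoin : run (i + (s : ZMod p) + 1 + (k : ZMod p) * (l : ZMod p)) (l - 1 - s) ++
      (run (i + (l : ZMod p) + (k : ZMod p) * (l : ZMod p)) s ++ L') =
      run (i + (s : ZMod p) + (k : ZMod p) * (l : ZMod p) + 1) (l - 1) ++ L' := by
    rw [← List.append_assoc]
    obtain ⟨u, rfl⟩ := Nat.exists_eq_add_of_lt hs
    rw [show s + u + 1 - 1 = u + s by omega, run_add, show u + s - s = u by omega]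
    congr 3 <;> push_cast <;> ring
  rw [hsplit, actList_append]
  change actList l (run i s)
    (act l (i + (s : ZMod p)) (actList l (run (i + (s : ZMod p) + 1) (l - 1 - s))
      (k, run (i + (l : ZMod p) + (k : ZMod p) * (l : ZMod p)) s ++ L'))) = _
  rw [actList_run_of_reduced (l - 1 - s), hjoin, act_run hl]
  · have e : i + (l : ZMod p) + (k : ZMod p) * (l : ZMod p) =
        i + ((k + 1 : ℤ) : ZMod p) * (l : ZMod p) := by push_cast; ring
    rw [e] at hx ⊢
    exact actList_run_of_reduced _ _ _ _ hx
  · rw [hjoin]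
    refine hL'.run_append (by omega) ?_
    have e : i + (s : ZMod p) + (k : ZMod p) * (l : ZMod p) + 1 + ((l - 1 : ℕ) : ZMod p) =
        i + (l : ZMod p) + (k : ZMod p) * (l : ZMod p) + (s : ZMod p) := by
      rw [Nat.cast_sub hl]
      push_cast
      ring
    rwa [e]

/-- Normal forms of elements of `G(p, l)`. -/
abbrev NormalForm (p l : ℕ) : Type := {x : ℤ × List (ZMod p) // Reduced l x.2}

/-- `act` on normal forms. -/
noncomputable def actNF (hl : 1 ≤ l) (i : ZMod p) (x : NormalForm p l) : NormalForm p l :=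
  ⟨act l i x, reduced_act hl i x x.2⟩

theorem foldr_actNF (hl : 1 ≤ l) (w : List (ZMod p)) (x : NormalForm p l) :
    (w.foldr (actNF hl) x).1 = actList l w x := by
  induction w with
  | nil => rfl
  | cons i w ih => exact congrArg (act l i) ih

/-- Left multiplication of normal forms by `Δ`. -/
def shiftNF (p l : ℕ) : Equiv.Perm (NormalForm p l) where
  toFun x := ⟨(x.1.1 + 1, x.1.2), x.2⟩
  invFun x := ⟨(x.1.1 - 1, x.1.2), x.2⟩
  left_inv x := by ext1; simp
  right_inv x := by ext1; simp

theorem foldr_actNF_run (hl : 1 ≤ l) (i : ZMod p) (x : NormalForm p l) :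
    (run i l).foldr (actNF hl) x = shiftNF p l x :=
  Subtype.ext (by rw [foldr_actNF, actList_run i _ x.2 hl]; rfl)

theorem actNF_bijective (hl : 1 ≤ l) (i : ZMod p) : Function.Bijective (actNF hl i) := by
  obtain ⟨t, rfl⟩ := Nat.exists_eq_add_of_le' hl
  constructor
  · -- a run ending in `i` acts bijectively
    have h : ∀ x, shiftNF p (t + 1) x =
        (run (i - (t : ZMod p)) t).foldr (actNF hl) (actNF hl i x) :=
      fun x => by
        rw [← foldr_actNF_run hl (i - (t : ZMod p)), run_add, List.foldr_append, sub_add_cancel]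
        rfl
    intro x y hxy
    apply (shiftNF p (t + 1)).injective
    rw [h, h, hxy]
  · -- a run starting with `i` acts bijectively
    intro y
    obtain ⟨x, rfl⟩ := (shiftNF p (t + 1)).surjective y
    exact ⟨(run (i + 1) t).foldr (actNF hl) x, foldr_actNF_run hl i x⟩

/-- The action of an atom on normal forms, as a permutation. -/
noncomputable def permNF (hl : 1 ≤ l) (i : ZMod p) : Equiv.Perm (NormalForm p l) :=
  Equiv.ofBijective _ (actNF_bijective hl i)

theorem prod_permNF (hl : 1 ≤ l) (w : List (ZMod p)) (x : NormalForm p l) :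
    (w.map (permNF hl)).prod x = w.foldr (actNF hl) x := by
  induction w with
  | nil => rfl
  | cons i w ih => rw [List.map_cons, List.prod_cons, Equiv.Perm.mul_apply, ih]; rfl

/-- A family `f` satisfying the circular relations defines a homomorphism on `G(p, l)`. -/
def lift {H : Type*} [Group H] (f : ZMod p → H)
    (hf : ∀ i, ((run i l).map f).prod = ((run 0 l).map f).prod) : CircularGroup p l →* H :=
  PresentedGroup.toGroup (f := f) (by
    rintro _ ⟨i, rfl⟩
    have e : ⇑(FreeGroup.lift f) ∘ FreeGroup.of = f := by ext; simp
    rw [map_mul, map_inv, mul_inv_eq_one, cyclicWord_eq, cyclicWord_eq, map_list_prod,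
      map_list_prod, List.map_map, List.map_map, e, hf i])

/-- The generator `a_i` of `G(p, l)`. -/
def atom (l : ℕ) (i : ZMod p) : CircularGroup p l := PresentedGroup.of i

@[simp] theorem lift_atom {H : Type*} [Group H] (f : ZMod p → H)
    (hf : ∀ i, ((run i l).map f).prod = ((run 0 l).map f).prod) (i : ZMod p) :
    lift f hf (atom l i) = f i :=
  PresentedGroup.toGroup.of _

variable (p l) in
/-- The element `Δ = a_0 ⋯ a_{l-1}` of `G(p, l)`. -/
def garside : CircularGroup p l := ((run 0 l).map (atom l)).prod

theorem prod_run (i : ZMod p) : ((run i l).map (atom l)).prod = garside p l := by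
  have h : (PresentedGroup.mk _ (cyclicWord p l 0 * (cyclicWord p l i)⁻¹) :
      CircularGroup p l) = 1 := PresentedGroup.one_of_mem ⟨i, rfl⟩
  have hw : ∀ j : ZMod p, (PresentedGroup.mk _ (cyclicWord p l j) : CircularGroup p l) =
      ((run j l).map (atom l)).prod := fun j => by
    refine (congrArg _ (cyclicWord_eq l j)).trans ?_
    rw [map_list_prod, List.map_map]
    rfl
  rw [map_mul, map_inv, mul_inv_eq_one, hw, hw] at h
  exact h.symm

theorem closure_range_atom : Subgroup.closure (Set.range (atom (p := p) l)) = ⊤ :=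
  PresentedGroup.closure_range_of _

theorem atom_mul_garside (i : ZMod p) :
    atom l i * garside p l = garside p l * atom l (i + (l : ZMod p)) := by
  have h := run_add i l 1
  have h' : run i (l + 1) = i :: run (i + 1) l := rfl
  have := congrArg (fun w => (w.map (atom l)).prod) (h'.symm.trans h)
  simpa [prod_run, run] using this

theorem atom_mul_garside_zpow (i : ZMod p) (k : ℤ) :
    atom l i * garside p l ^ k = garside p l ^ k * atom l (i + (k : ZMod p) * (l : ZMod p)) := by
  induction k generalizing i with
  | zero => simp
  | succ k ih =>
    rw [zpow_add_one, ← mul_assoc, ih, mul_assoc, atom_mul_garside, mul_assoc]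
    congr 3
    push_cast
    ring
  | pred k ih =>
    have h : ∀ j : ZMod p, atom l j * (garside p l)⁻¹ =
        (garside p l)⁻¹ * atom l (j - (l : ZMod p)) :=
      fun j => by
        rw [mul_inv_eq_iff_eq_mul, mul_assoc, atom_mul_garside, sub_add_cancel,
          inv_mul_cancel_left]
    rw [zpow_sub_one, ← mul_assoc, ih, mul_assoc, h, mul_assoc]
    congr 3
    push_cast
    ring

/-- The length homomorphism, taking every atom to `1`. -/
def len (p l : ℕ) : CircularGroup p l →* Multiplicative ℤ :=
  lift (fun _ => Multiplicative.ofAdd 1) fun i => by simp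

/-- The action of `G(p, l)` on normal forms. -/
noncomputable def toPerm (hl : 1 ≤ l) : CircularGroup p l →* Equiv.Perm (NormalForm p l) :=
  lift (permNF hl) fun i => Equiv.ext fun x => by
    rw [prod_permNF, prod_permNF, foldr_actNF_run, foldr_actNF_run]

/-- The group element `Δ ^ k * a_{L₀} * a_{L₁} ⋯` with normal form `(k, L)`. -/
def eval (l : ℕ) (x : ℤ × List (ZMod p)) : CircularGroup p l :=
  garside p l ^ x.1 * (x.2.map (atom l)).prod

theorem eval_act (hl : 1 ≤ l) (i : ZMod p) (x : ℤ × List (ZMod p)) (hx : Reduced l x.2) :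
    eval l (act l i x) = atom l i * eval l x := by
  obtain ⟨k, L⟩ := x
  have comm : atom l i * eval l (k, L) =
      garside p l ^ k * (((i + (k : ZMod p) * (l : ZMod p)) :: L).map (atom l)).prod := by
    rw [eval, ← mul_assoc, atom_mul_garside_zpow, mul_assoc]
    rfl
  rcases act_cases hl i k L hx with ⟨h, h'⟩ | ⟨L', rfl, h⟩
  · rw [h, comm]
    rfl
  · have e : (i + (k : ZMod p) * (l : ZMod p)) ::
        (run (i + (k : ZMod p) * (l : ZMod p) + 1) (l - 1) ++ L') =
        run (i + (k : ZMod p) * (l : ZMod p)) l ++ L' := by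
      obtain ⟨t, rfl⟩ := Nat.exists_eq_add_of_le' hl
      rfl
    rw [h, comm, e, List.map_append, List.prod_append, prod_run, eval, zpow_add_one, mul_assoc]

theorem eval_toPerm (hl : 1 ≤ l) (g : CircularGroup p l) :
    ∀ x, eval l (toPerm hl g x : NormalForm p l).1 = g * eval l x.1 := by
  have hg : g ∈ Subgroup.closure (Set.range (atom (p := p) l)) :=
    closure_range_atom ▸ Subgroup.mem_top g
  induction hg using Subgroup.closure_induction with
  | mem g hg =>
    obtain ⟨i, rfl⟩ := hg
    intro x
    rw [toPerm, lift_atom]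
    exact eval_act hl i x.1 x.2
  | one => intro x; simp
  | mul g h _ _ hg hh => intro x; rw [map_mul, Equiv.Perm.mul_apply, hg, hh, mul_assoc]
  | inv g _ hg =>
    intro x
    rw [eq_inv_mul_iff_mul_eq, ← hg, ← Equiv.Perm.mul_apply, ← map_mul, mul_inv_cancel, map_one]
    rfl

/-- The normal form of an element of `G(p, l)`. -/
noncomputable def normalForm (hl : 1 ≤ l) (g : CircularGroup p l) : ℤ × List (ZMod p) :=
  (toPerm hl g ⟨(0, []), trivial⟩).1

theorem eval_normalForm (hl : 1 ≤ l) (g : CircularGroup p l) : eval l (normalForm hl g) = g := by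
  rw [normalForm, eval_toPerm]
  simp [eval]

theorem normalForm_atom_mul (hl : 1 ≤ l) (i : ZMod p) (g : CircularGroup p l) :
    normalForm hl (atom l i * g) = act l i (normalForm hl g) := by
  rw [normalForm, map_mul, Equiv.Perm.mul_apply, toPerm, lift_atom]
  rfl

theorem reduced_normalForm (hl : 1 ≤ l) (g : CircularGroup p l) :
    Reduced l (normalForm hl g).2 :=
  (toPerm hl g _).2

theorem normalForm_nonneg (hl : 1 ≤ l) {g : CircularGroup p l}
    (hg : g ∈ Submonoid.closure (Set.range (atom (p := p) l))) : 0 ≤ (normalForm hl g).1 := by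
  obtain ⟨L, rfl⟩ := IsGarsideFamily.exists_list hg
  induction L with
  | nil => simp [normalForm]
  | cons i L ih =>
    have ih := ih (Submonoid.list_prod_mem _ fun x hx => by
      obtain ⟨j, _, rfl⟩ := List.mem_map.1 hx
      exact IsGarsideFamily.atom_mem j)
    rw [List.map_cons, List.prod_cons, normalForm_atom_mul]
    rcases act_cases hl i _ _ (reduced_normalForm hl (L.map (atom l)).prod) with
      ⟨h, _⟩ | ⟨L', _, h⟩ <;> rw [Prod.mk.eta] at h <;> rw [h]
    · exact ih
    · exact ih.trans (by simp)

theorem prod_mem (L : List (ZMod p)) :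
    (L.map (atom l)).prod ∈ Submonoid.closure (Set.range (atom (p := p) l)) :=
  Submonoid.list_prod_mem _ fun x hx => by
    obtain ⟨j, _, rfl⟩ := List.mem_map.1 hx
    exact IsGarsideFamily.atom_mem j

/-- A positive element that `a_i` divides is divisible by `Δ`, or `a_i` is the first letter of its
normal form. -/
theorem garside_dvd_or_head (hl : 1 ≤ l) (i : ZMod p) {g : CircularGroup p l}
    (hi : (atom l i)⁻¹ * g ∈ Submonoid.closure (Set.range (atom (p := p) l))) :
    (garside p l)⁻¹ * g ∈ Submonoid.closure (Set.range (atom (p := p) l)) ∨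
      (normalForm hl g).2.head? = some i := by
  by_cases hpos : 1 ≤ (normalForm hl g).1
  · left
    obtain ⟨t, ht⟩ := Int.eq_ofNat_of_zero_le (sub_nonneg.2 hpos)
    have e : (garside p l)⁻¹ * g =
        garside p l ^ t * ((normalForm hl g).2.map (atom l)).prod := by
      conv_lhs => rw [← eval_normalForm hl g]
      rw [eval, ← mul_assoc, ← zpow_neg_one, ← zpow_add, ← zpow_natCast, ← ht]
      congr 2
      ring
    rw [e]
    exact Submonoid.mul_mem _ (Submonoid.pow_mem _ (prod_mem _) _) (prod_mem _)
  · right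
    have hnn := normalForm_nonneg hl hi
    have hg : normalForm hl g = act l i (normalForm hl ((atom l i)⁻¹ * g)) := by
      rw [← normalForm_atom_mul, mul_inv_cancel_left]
    rcases act_cases hl i _ _ (reduced_normalForm hl ((atom l i)⁻¹ * g)) with
      ⟨h, _⟩ | ⟨L', _, h⟩ <;> rw [Prod.mk.eta, ← hg] at h <;> rw [h] at hpos ⊢
    · have : (normalForm hl ((atom l i)⁻¹ * g)).1 = 0 := by
        simp only at hpos
        omega
      simp [this]
    · simp only at hpos
      omega

/-! ### Circular groups are Garside groups -/

theorem isGarsideFamily (hl : 1 ≤ l) :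
    IsGarsideFamily (atom (p := p) l) (garside p l) (len p l) where
  len_atom i := lift_atom _ _ i
  atom_dvd i := by
    obtain ⟨t, rfl⟩ := Nat.exists_eq_add_of_le' hl
    rw [← prod_run i, run, List.map_cons, List.prod_cons, inv_mul_cancel_left]
    exact prod_mem _
  conj i := ⟨_, atom_mul_garside i⟩
  conj_symm i := ⟨i - (l : ZMod p), by rw [atom_mul_garside, sub_add_cancel]⟩
  dvd_of_two i j hij g _ hi hj := by
    rcases garside_dvd_or_head hl i hi with h | h
    · exact h
    rcases garside_dvd_or_head hl j hj with h' | h'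
    · exact h'
    · exact absurd (Option.some.inj (h.symm.trans h')) hij

theorem reverse_run (i : ZMod p) (t : ℕ) : (run i t).reverse.map (fun j => -j) =
    run (1 - i - (t : ZMod p)) t := by
  induction t generalizing i with
  | zero => rfl
  | succ t ih =>
    rw [run_add (1 - i - ((t + 1 : ℕ) : ZMod p)) t 1, run, List.reverse_cons, List.map_append, ih]
    simp only [run, List.map_cons, List.map_nil]
    congr 2
    · push_cast; ring
    · push_cast; ring

/-- The anti-automorphism of `G(p, l)` that takes `a_i` to `a_{-i}`. -/
def reversal (p l : ℕ) : CircularGroup p l →* (CircularGroup p l)ᵐᵒᵖ :=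
  lift (fun i => MulOpposite.op (atom l (-i))) (by
    have h : ∀ i : ZMod p, ((run i l).map fun i => MulOpposite.op (atom l (-i))).prod =
        MulOpposite.op (garside p l) := fun i => by
      apply MulOpposite.unop_injective
      rw [MulOpposite.unop_list_prod, List.map_map, MulOpposite.unop_op,
        ← prod_run (1 - i - (l : ZMod p)), ← reverse_run, List.map_map, List.map_reverse]
      rfl
    intro i
    rw [h, h])

theorem reversal_atom (i : ZMod p) :
    reversal p l (atom l i) = MulOpposite.op (atom l (-i)) :=
  lift_atom _ _ i

theorem hasLeftInf (hl : 1 ≤ l) :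
    HasLeftInf (Submonoid.closure (Set.range (atom (p := p) l))) :=
  (isGarsideFamily hl).hasLeftInf closure_range_atom

theorem hasRightInf (hl : 1 ≤ l) :
    HasRightInf (Submonoid.closure (Set.range (atom (p := p) l))) := by
  refine (hasLeftInf hl).hasRightInf (fun g => (reversal p l g).unop) (fun g h => by simp)
    (fun g => ?_) fun g hg => ?_
  · have hg : g ∈ Subgroup.closure (Set.range (atom (p := p) l)) :=
      closure_range_atom ▸ Subgroup.mem_top g
    induction hg using Subgroup.closure_induction with
    | mem g hg => obtain ⟨i, rfl⟩ := hg; simp [reversal_atom]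
    | one => simp
    | mul g h _ _ hg hh => simpa using congrArg₂ (· * ·) hg hh
    | inv g _ hg => simpa using congrArg (·⁻¹) hg
  · induction hg using Submonoid.closure_induction with
    | mem g hg =>
      obtain ⟨i, rfl⟩ := hg
      rw [reversal_atom]
      exact IsGarsideFamily.atom_mem (-i)
    | one => simp
    | mul g h _ _ hg hh => simpa using Submonoid.mul_mem _ hh hg

theorem isGarsideGroup (hp : 1 ≤ p) (hl : 1 ≤ l) : IsGarsideGroup (CircularGroup p l) := by
  have : NeZero p := ⟨by omega⟩
  exact (isGarsideFamily hl).isGarsideGroup closure_range_atom (hasRightInf hl)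

theorem eq_one_of_isOfFinOrder (hl : 1 ≤ l) (g : CircularGroup p l) (hg : IsOfFinOrder g) :
    g = 1 :=
  (hasLeftInf hl).eq_one_of_isOfFinOrder (fun _ => (isGarsideFamily hl).antisymm) g hg

end CircularGroup

/-! ### Powers of commuting elements -/

section Commute

variable {G : Type*} [Group G] {a b : G}

theorem Commute.zpow_mul_zpow_mul (h : Commute a b) (i j k l : ℤ) :
    a ^ i * b ^ j * (a ^ k * b ^ l) = a ^ (i + k) * b ^ (j + l) := by
  rw [mul_assoc, ← mul_assoc (b ^ j), ← (h.zpow_zpow k j).eq, zpow_add, zpow_add]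
  simp only [mul_assoc]

theorem Commute.zpow_mul_zpow_zpow (h : Commute a b) (i j k : ℤ) :
    (a ^ i * b ^ j) ^ k = a ^ (i * k) * b ^ (j * k) := by
  rw [(h.zpow_zpow i j).mul_zpow, zpow_mul, zpow_mul]

end Commute

/-! ### Families satisfying the braid relations -/

section BraidFamily

variable {G H : Type*} [Group G] [Group H] {n : ℕ}

theorem xProd_one_zero (x : Fin n → G) : xProd x 1 0 = 1 := by simp [xProd]

theorem xProd_one_succ (x : Fin n → G) {j : ℕ} (hj : j < n) :
    xProd x 1 (j + 1) = xProd x 1 j * x ⟨j, hj⟩ := by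
  simp only [xProd, Nat.sub_self, List.drop_zero]
  rw [List.prod_take_succ _ _ (by simpa using hj)]
  simp

theorem xProd_eq (x : Fin n → G) {i j : ℕ} (hij : i ≤ j) :
    xProd x (i + 1) j = (xProd x 1 i)⁻¹ * xProd x 1 j := by
  rw [eq_inv_mul_iff_mul_eq]
  simp only [xProd, Nat.sub_self, List.drop_zero, Nat.add_sub_cancel]
  conv_rhs => rw [← List.prod_take_mul_prod_drop _ i]
  rw [List.take_take, min_eq_left hij]

theorem map_xProd (f : G →* H) (x : Fin n → G) (i j : ℕ) :
    f (xProd x i j) = xProd (fun k => f (x k)) i j := by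
  simp only [xProd, map_list_prod, List.map_drop, List.map_take, List.map_ofFn]
  rfl

theorem image_commRelators (f : G →* H) (x : Fin n → G) (y z : G) :
    f '' commRelators x y z = commRelators (fun k => f (x k)) (f y) (f z) := by
  simp [commRelators, map_xProd]

theorem image_shiftRelators (f : G →* H) (m : ℕ) (x : Fin n → G) (y z : G) :
    f '' shiftRelators m x y z = shiftRelators m (fun k => f (x k)) (f y) (f z) := by
  ext w
  constructor
  · rintro ⟨_, ⟨i, h1, h2, rfl⟩ | ⟨i, h1, h2, rfl⟩, rfl⟩
    · exact Or.inl ⟨i, h1, h2, by simp [map_xProd]⟩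
    · exact Or.inr ⟨i, h1, h2, by simp [map_xProd]⟩
  · rintro (⟨i, h1, h2, rfl⟩ | ⟨i, h1, h2, rfl⟩)
    · exact ⟨_, Or.inl ⟨i, h1, h2, rfl⟩, by simp [map_xProd]⟩
    · exact ⟨_, Or.inr ⟨i, h1, h2, rfl⟩, by simp [map_xProd]⟩

/-- The elements `x_1, …, x_n, y, z` of a group satisfy the defining relations of
`B_*^*(n, m)`. -/
def IsBraidFamily (m : ℕ) (x : Fin n → G) (y z : G) : Prop :=
  ∀ w ∈ commRelators x y z ∪ shiftRelators m x y z, w = 1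

/-- The element `Θ = z δ^q x_1 ⋯ x_r y^{-q}`, where `m = q n + r`. In a group satisfying the braid
relations, extend `x` to `ℤ` by `x_{i+n} = y x_i y⁻¹`: then `Θ = z x_1 ⋯ x_m`, `Θ` commutes
with `y`, and `Θ⁻¹ x_i Θ = x_{i+m}`. -/
def braidTheta (m : ℕ) (x : Fin n → G) (y z : G) : G :=
  z * (xProd x 1 n * y) ^ (m / n) * xProd x 1 (m % n) * (y ^ (m / n))⁻¹

/-- The element `T = y^α Θ^{-β}`, which shifts the sequence `x` by one if `α n + β m = 1`. -/
def braidT (m : ℕ) (α β : ℤ) (x : Fin n → G) (y z : G) : G :=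
  y ^ α * braidTheta m x y z ^ (-β)

/-- The central element `C = y^m Θ^n`. -/
def braidC (m : ℕ) (x : Fin n → G) (y z : G) : G :=
  y ^ (m : ℤ) * braidTheta m x y z ^ (n : ℤ)

/-- The element `w = x_1 T`. -/
def braidW [NeZero n] (m : ℕ) (α β : ℤ) (x : Fin n → G) (y z : G) : G :=
  x 0 * braidT m α β x y z

theorem map_braidTheta (f : G →* H) (m : ℕ) (x : Fin n → G) (y z : G) :
    f (braidTheta m x y z) = braidTheta m (fun k => f (x k)) (f y) (f z) := by
  simp [braidTheta, map_xProd]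

theorem map_braidT (f : G →* H) (m : ℕ) (α β : ℤ) (x : Fin n → G) (y z : G) :
    f (braidT m α β x y z) = braidT m α β (fun k => f (x k)) (f y) (f z) := by
  simp [braidT, map_braidTheta]

theorem map_braidC (f : G →* H) (m : ℕ) (x : Fin n → G) (y z : G) :
    f (braidC m x y z) = braidC m (fun k => f (x k)) (f y) (f z) := by
  simp [braidC, map_braidTheta]

theorem map_braidW [NeZero n] (f : G →* H) (m : ℕ) (α β : ℤ) (x : Fin n → G) (y z : G) :
    f (braidW m α β x y z) = braidW m α β (fun k => f (x k)) (f y) (f z) := by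
  simp [braidW, map_braidT]

/-- The elements `x_1, …, x_n` attached to `T` and `w`: with indices shifted to start at `0`,
`x_j = T^j w T^{-(j+1)}`. -/
def shiftX (n : ℕ) (T w : G) (j : Fin n) : G := T ^ (j : ℤ) * w * (T ^ ((j : ℤ) + 1))⁻¹

theorem map_shiftX (f : G →* H) (T w : G) (j : Fin n) :
    f (shiftX n T w j) = shiftX n (f T) (f w) j := by
  simp [shiftX]

theorem xProd_shiftX (T w : G) {j : ℕ} (hj : j ≤ n) :
    xProd (shiftX n T w) 1 j = w ^ (j : ℤ) * T ^ (-(j : ℤ)) := by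
  induction j with
  | zero => simp [xProd_one_zero]
  | succ j ih =>
    rw [xProd_one_succ _ hj, ih (by omega), shiftX]
    push_cast
    group

/-- With `δ = w^n C^β`, the common shape of both sides of the shift relations. -/
theorem xProd_shiftX_conj (T w C : G) (s c : ℤ) {i k : ℕ} (hi : i ≤ n)
    (hk : k ≤ n) :
    (xProd (shiftX n T w) 1 i)⁻¹ * (w ^ s * C ^ c) * xProd (shiftX n T w) 1 k =
      T ^ (i : ℤ) * w ^ (s - i) * (C ^ c * w ^ (k : ℤ)) * T ^ (-(k : ℤ)) := by
  rw [xProd_shiftX T w hi, xProd_shiftX T w hk]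
  group

/-- Elements built from `T`, `w` and a central `C` satisfy the braid relations. -/
theorem isBraidFamily_shiftX {m : ℕ} {α β : ℤ} {T w C : G} (hn : 0 < n)
    (hT : Commute T C) (hw : Commute w C) :
    IsBraidFamily m (shiftX n T w) (T ^ (n : ℤ) * C ^ β) (C ^ α * w ^ (-(m : ℤ))) := by
  have hδ : xProd (shiftX n T w) 1 n * (T ^ (n : ℤ) * C ^ β) = w ^ (n : ℤ) * C ^ β := by
    rw [xProd_shiftX T w le_rfl]
    group
  have hz : C ^ α * w ^ (-(m : ℤ)) = w ^ (-(m : ℤ)) * C ^ α :=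
    (hw.zpow_zpow _ _).eq.symm
  have hmid : ∀ e : ℤ, w ^ (n : ℤ) * C ^ β * (C ^ α * w ^ (-(m : ℤ))) *
      (w ^ (n : ℤ) * C ^ β) ^ e = w ^ ((n : ℤ) - m + n * e) * C ^ (β + α + β * e) := fun e => by
    rw [hz, hw.zpow_mul_zpow_zpow, hw.zpow_mul_zpow_mul, hw.zpow_mul_zpow_mul, sub_eq_add_neg]
  have hconj : ∀ (e : ℤ) (i k : ℕ), i ≤ n → k ≤ n → ((n : ℤ) - m + n * e - i + k = 0) →
      (xProd (shiftX n T w) (i + 1) n * (T ^ (n : ℤ) * C ^ β) * (C ^ α * w ^ (-(m : ℤ))) *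
        (xProd (shiftX n T w) 1 n * (T ^ (n : ℤ) * C ^ β)) ^ e * xProd (shiftX n T w) 1 k) =
      T ^ ((i : ℤ) - k) * C ^ (β + α + β * e) := by
    intro e i k hi hk he
    have h1 := hmid e
    rw [xProd_eq _ hi, mul_assoc (xProd (shiftX n T w) 1 i)⁻¹, hδ,
      mul_assoc (xProd (shiftX n T w) 1 i)⁻¹, mul_assoc (xProd (shiftX n T w) 1 i)⁻¹, h1,
      xProd_shiftX_conj _ _ _ _ _ hi hk, ← (hw.zpow_zpow _ _).eq, mul_assoc (T ^ (i : ℤ)),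
      ← mul_assoc (w ^ _), ← zpow_add, he, zpow_zero, one_mul, mul_assoc,
      ← (hT.zpow_zpow _ _).eq, ← mul_assoc, ← zpow_add, sub_eq_add_neg]
  have hqr : (n : ℤ) * (m / n : ℕ) + (m % n : ℕ) = m := by exact_mod_cast Nat.div_add_mod m n
  have hr : m % n < n := Nat.mod_lt m hn
  rintro _ (rfl | ⟨i, h1, h2, rfl⟩ | ⟨i, h1, h2, rfl⟩)
  · rw [mul_inv_eq_one, mul_assoc (C ^ α * _), hδ, hz, hw.zpow_mul_zpow_mul,
      hw.zpow_mul_zpow_mul, add_comm (n : ℤ), add_comm β]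
  · obtain ⟨i, rfl⟩ := Nat.exists_eq_add_of_le' h1
    rw [mul_inv_eq_one, hconj _ (i + 1) _ (by omega) (by omega), show i + 1 + m % n - 1 =
      i + m % n by omega, hconj _ i _ (by omega) (by omega)]
    · simp only [Nat.cast_add]; congr 2; ring
    · simp only [Nat.cast_add]; linear_combination hqr
    · simp only [Nat.cast_add]; linear_combination hqr
  · obtain ⟨i, rfl⟩ := Nat.exists_eq_add_of_le' (show 1 ≤ i by omega)
    have hcast : ∀ j : ℕ, n ≤ j + m % n → ((j + m % n - n : ℕ) : ℤ) = j + (m % n : ℕ) - n :=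
      fun j hj => by rw [Nat.cast_sub hj, Nat.cast_add]
    simp only [← zpow_natCast (xProd (shiftX n T w) 1 n * _)]
    rw [mul_inv_eq_one, hconj _ (i + 1) _ (by omega) (by omega), show i + 1 + m % n - n - 1 =
      i + m % n - n by omega, hconj _ i _ (by omega) (by omega)]
    · rw [hcast _ (by omega), hcast _ (by omega)]; push_cast; congr 2; ring
    · rw [hcast _ (by omega)]; linear_combination hqr
    · rw [hcast _ (by omega)]; simp only [Nat.cast_add]; linear_combination hqr

theorem braidTheta_shiftX {m : ℕ} {α β : ℤ} {T w C : G} (hn : 0 < n)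
    (hT : Commute T C) (hw : Commute w C) :
    braidTheta m (shiftX n T w) (T ^ (n : ℤ) * C ^ β) (C ^ α * w ^ (-(m : ℤ))) =
      T ^ (-(m : ℤ)) * C ^ α := by
  have hδ : xProd (shiftX n T w) 1 n * (T ^ (n : ℤ) * C ^ β) = w ^ (n : ℤ) * C ^ β := by
    rw [xProd_shiftX T w le_rfl]
    group
  have hqr : (n : ℤ) * (m / n : ℕ) + (m % n : ℕ) = m := by exact_mod_cast Nat.div_add_mod m n
  have hz : C ^ α * w ^ (-(m : ℤ)) = w ^ (-(m : ℤ)) * C ^ α :=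
    (hw.zpow_zpow _ _).eq.symm
  have hr : m % n < n := Nat.mod_lt m hn
  rw [braidTheta, hδ, xProd_shiftX T w hr.le, ← zpow_natCast, ← zpow_natCast,
    hw.zpow_mul_zpow_zpow, hT.zpow_mul_zpow_zpow, hz, hw.zpow_mul_zpow_mul]
  generalize ((m / n : ℕ) : ℤ) = q at *
  generalize ((m % n : ℕ) : ℤ) = r at *
  have h1 : w ^ (-(m : ℤ) + n * q) * C ^ (α + β * q) * (w ^ r * T ^ (-r)) =
      T ^ (-r) * C ^ (α + β * q) := by
    rw [mul_assoc, ← mul_assoc (C ^ _), ← (hw.zpow_zpow _ _).eq, mul_assoc, ← mul_assoc,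
      ← zpow_add, show -(m : ℤ) + n * q + r = 0 by linear_combination hqr, zpow_zero, one_mul,
      (hT.zpow_zpow _ _).eq]
  rw [h1, mul_inv_eq_iff_eq_mul, hT.zpow_mul_zpow_mul]
  congr 2
  linear_combination -hqr

theorem braidT_shiftX {m : ℕ} {α β : ℤ} {T w C : G} (hn : 0 < n) (hαβ : α * n + β * m = 1)
    (hT : Commute T C) (hw : Commute w C) :
    braidT m α β (shiftX n T w) (T ^ (n : ℤ) * C ^ β) (C ^ α * w ^ (-(m : ℤ))) = T := by
  rw [braidT, braidTheta_shiftX hn hT hw, hT.zpow_mul_zpow_zpow, hT.zpow_mul_zpow_zpow,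
    hT.zpow_mul_zpow_mul, show (n : ℤ) * α + -m * -β = 1 by linear_combination hαβ,
    show β * α + α * -β = 0 by ring, zpow_one, zpow_zero, mul_one]

theorem braidC_shiftX {m : ℕ} {α β : ℤ} {T w C : G} (hn : 0 < n) (hαβ : α * n + β * m = 1)
    (hT : Commute T C) (hw : Commute w C) :
    braidC m (shiftX n T w) (T ^ (n : ℤ) * C ^ β) (C ^ α * w ^ (-(m : ℤ))) = C := by
  rw [braidC, braidTheta_shiftX hn hT hw, hT.zpow_mul_zpow_zpow, hT.zpow_mul_zpow_zpow,
    hT.zpow_mul_zpow_mul, show (n : ℤ) * m + -m * n = 0 by ring,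
    show β * m + α * n = 1 by linear_combination hαβ, zpow_one, zpow_zero, one_mul]

theorem braidW_shiftX [NeZero n] {m : ℕ} {α β : ℤ} {T w C : G} (hαβ : α * n + β * m = 1)
    (hT : Commute T C) (hw : Commute w C) :
    braidW m α β (shiftX n T w) (T ^ (n : ℤ) * C ^ β) (C ^ α * w ^ (-(m : ℤ))) = w := by
  rw [braidW, braidT_shiftX (Nat.pos_of_neZero n) hαβ hT hw]
  simp [shiftX]

/-- Conjugation by `g` shifts the sequence `X` by `s`. -/
def Shifts (X : ℤ → G) (g : G) (s : ℤ) : Prop := ∀ j, g * X j = X (j + s) * g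

namespace Shifts

variable {X : ℤ → G} {g h : G} {s t : ℤ}

theorem mul (hg : Shifts X g s) (hh : Shifts X h t) : Shifts X (g * h) (s + t) := fun j => by
  rw [mul_assoc, hh, ← mul_assoc, hg, mul_assoc, add_right_comm, ← add_assoc]

theorem inv (hg : Shifts X g s) : Shifts X g⁻¹ (-s) := fun j => by
  rw [inv_mul_eq_iff_eq_mul, ← mul_assoc, hg, neg_add_cancel_right, mul_inv_cancel_right]

theorem zpow (hg : Shifts X g s) (k : ℤ) : Shifts X (g ^ k) (s * k) := by
  induction k with
  | zero => intro j; simp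
  | succ k ih => rw [zpow_add_one, mul_add, mul_one]; exact ih.mul hg
  | pred k ih => rw [zpow_sub_one, mul_sub, mul_one]; exact ih.mul hg.inv

theorem eq_conj (hg : Shifts X g 1) (j : ℤ) : X j = g ^ j * X 0 * (g ^ j)⁻¹ := by
  rw [eq_mul_inv_iff_mul_eq, hg.zpow j 0, zero_add, one_mul]

end Shifts

/-- The extension of `x_1, …, x_n` to a sequence with `x_{j+n} = y x_j y⁻¹` (indices starting
at `0`). -/
def extendX [NeZero n] (x : Fin n → G) (y : G) (j : ℤ) : G :=
  y ^ (j / n) * x (Fin.ofNat n (j % n).toNat) * (y ^ (j / n))⁻¹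

theorem extendX_natCast [NeZero n] (x : Fin n → G) (y : G) {j : ℕ} (hj : j < n) :
    extendX x y j = x ⟨j, hj⟩ := by
  have h1 : (j : ℤ) / n = 0 := by exact_mod_cast Nat.div_eq_of_lt hj
  have h2 : ((j : ℤ) % n).toNat = j := by
    rw [← Int.natCast_mod, Int.toNat_natCast, Nat.mod_eq_of_lt hj]
  have h3 : Fin.ofNat n j = ⟨j, hj⟩ := Fin.ext (Nat.mod_eq_of_lt hj)
  rw [extendX, h1, h2, h3]
  simp

theorem extendX_add [NeZero n] (x : Fin n → G) (y : G) (j a : ℤ) :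
    extendX x y (j + n * a) = y ^ a * extendX x y j * (y ^ a)⁻¹ := by
  have hn : (n : ℤ) ≠ 0 := by exact_mod_cast NeZero.ne n
  rw [extendX, extendX, Int.add_mul_ediv_left _ _ hn, Int.add_mul_emod_self_left,
    add_comm (j / n), zpow_add]
  group

theorem shifts_y [NeZero n] (x : Fin n → G) (y : G) : Shifts (extendX x y) y n := fun j => by
  have := extendX_add x y j 1
  rw [mul_one, zpow_one] at this
  rw [this, inv_mul_cancel_right]

namespace IsBraidFamily

variable {m : ℕ} {x : Fin n → G} {y z : G}

theorem commute (h : IsBraidFamily m x y z) : Commute (xProd x 1 n * y) z := by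
  have := h _ (Or.inl rfl)
  rw [mul_inv_eq_one] at this
  rw [Commute, SemiconjBy, this, mul_assoc]

/-- The first group of shift relations, for the element `Π = z δ^q x_1 ⋯ x_r`. -/
theorem prefix_first (h : IsBraidFamily m x y z) {j : ℕ} (hj : j + m % n ≤ n) :
    (xProd x 1 j)⁻¹ * (z * (xProd x 1 n * y) ^ (m / n)) * xProd x 1 (j + m % n) =
      z * (xProd x 1 n * y) ^ (m / n) * xProd x 1 (m % n) := by
  induction j with
  | zero => simp [xProd_one_zero]
  | succ j ih =>
    rw [← ih (by omega)]
    have h1 := h _ (Or.inr (Or.inl ⟨j + 1, by omega, by omega, rfl⟩))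
    rw [mul_inv_eq_one, xProd_eq x (show j + 1 ≤ n by omega), xProd_eq x (show j ≤ n by omega),
      show j + 1 + m % n - 1 = j + m % n by omega] at h1
    have hδ : xProd x 1 n * y * z * (xProd x 1 n * y) ^ (((m / n : ℕ) : ℤ) - 1) =
        z * (xProd x 1 n * y) ^ (m / n) := by
      rw [h.commute.eq, mul_assoc, ← zpow_one_add, add_sub_cancel, zpow_natCast]
    rw [← hδ]
    simpa only [mul_assoc] using h1

/-- The second group of shift relations. -/
theorem prefix_second (h : IsBraidFamily m x y z) (hr : m % n ≤ n) {j : ℕ} (hj : j ≤ m % n) :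
    (xProd x 1 (n - m % n + j))⁻¹ * (z * (xProd x 1 n * y) ^ (m / n)) * (xProd x 1 n * y) *
      xProd x 1 j = z * (xProd x 1 n * y) ^ (m / n) * xProd x 1 (m % n) * y := by
  induction j with
  | zero =>
    rw [← h.prefix_first (j := n - m % n) (by omega), Nat.sub_add_cancel hr, xProd_one_zero,
      add_zero]
    simp only [mul_assoc, mul_one]
  | succ j ih =>
    rw [← ih (by omega)]
    have h1 := h _ (Or.inr (Or.inr ⟨n - m % n + j + 1, by omega, by omega, rfl⟩))
    have hδ : z * (xProd x 1 n * y) ^ (m / n) * (xProd x 1 n * y) =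
        xProd x 1 n * y * z * (xProd x 1 n * y) ^ (m / n) := by
      rw [h.commute.eq, mul_assoc, mul_assoc, ← pow_succ, ← pow_succ']
    have key : ∀ i ≤ n, ∀ c, (xProd x 1 i)⁻¹ * (z * (xProd x 1 n * y) ^ (m / n)) *
        (xProd x 1 n * y) * c =
        xProd x (i + 1) n * y * z * (xProd x 1 n * y) ^ (m / n) * c := fun i hi c => by
      rw [xProd_eq x hi, mul_assoc _ _ (xProd x 1 n * y), hδ]
      simp only [mul_assoc]
    rw [mul_inv_eq_one, show n - m % n + j + 1 + m % n - n = j + 1 by omega,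
      Nat.add_sub_cancel] at h1
    rw [key _ (by omega), key _ (by omega)]
    exact h1

/-- `Π = z δ^q x_1 ⋯ x_r` commutes with `y`. -/
theorem commute_y (h : IsBraidFamily m x y z) (hr : m % n ≤ n) :
    Commute (z * (xProd x 1 n * y) ^ (m / n) * xProd x 1 (m % n)) y := by
  have h1 := h.prefix_second hr le_rfl
  have hδ : z * (xProd x 1 n * y) ^ (m / n) * (xProd x 1 n * y) =
      xProd x 1 n * y * (z * (xProd x 1 n * y) ^ (m / n)) := by
    rw [← mul_assoc _ z, h.commute.eq, mul_assoc, mul_assoc, ← pow_succ, ← pow_succ']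
  rw [Nat.sub_add_cancel hr, mul_assoc _ _ (xProd x 1 n * y), hδ, mul_assoc (xProd x 1 n) y,
    inv_mul_cancel_left, mul_assoc] at h1
  exact h1.symm

/-- `Π = z δ^q x_1 ⋯ x_r` shifts the sequence `x` by `-r`. -/
theorem shifts [NeZero n] (h : IsBraidFamily m x y z) :
    Shifts (extendX x y) (z * (xProd x 1 n * y) ^ (m / n) * xProd x 1 (m % n))
      (-(m % n : ℕ)) := by
  have hr : m % n < n := Nat.mod_lt m (Nat.pos_of_neZero n)
  have hcomm := h.commute_y hr.le
  have hfirst := fun j => h.prefix_first (j := j)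
  have hsecond := fun j => h.prefix_second hr.le (j := j)
  generalize z * (xProd x 1 n * y) ^ (m / n) * xProd x 1 (m % n) = P at *
  have base : ∀ b : ℕ, b < n →
      extendX x y b * P = P * extendX x y (b + (m % n : ℕ)) := by
    intro b hb
    rw [extendX_natCast x y hb]
    by_cases hbr : b + m % n < n
    · rw [← Nat.cast_add, extendX_natCast x y hbr]
      have h1 := hfirst b hbr.le
      have h2 := hfirst (b + 1) (by omega)
      rw [show b + 1 + m % n = b + m % n + 1 by omega, xProd_one_succ x hbr,
        xProd_one_succ x hb, mul_inv_rev] at h2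
      conv_lhs => rw [← h2]
      rw [← h1]
      group
    · obtain ⟨j, rfl⟩ : ∃ j, b = n - m % n + j := ⟨b - (n - m % n), by omega⟩
      have hjn : j < n := by omega
      have h1 := hsecond j (by omega)
      have h2 := hsecond (j + 1) (by omega)
      rw [← add_assoc, xProd_one_succ x hb, xProd_one_succ x hjn, mul_inv_rev] at h2
      have e : ((n - m % n + j : ℕ) : ℤ) + (m % n : ℕ) = (j : ℤ) + n * 1 := by
        rw [Nat.cast_add, Nat.cast_sub hr.le]
        ring
      rw [e, extendX_add, extendX_natCast x y hjn, zpow_one, ← mul_assoc, ← mul_assoc,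
        eq_mul_inv_iff_mul_eq, mul_assoc]
      conv_lhs => rw [← h2]
      rw [← h1]
      group
  have hn : (0 : ℤ) < n := by exact_mod_cast Nat.pos_of_neZero n
  have all : ∀ j : ℤ, extendX x y j * P = P * extendX x y (j + (m % n : ℕ)) := by
    intro j
    have hb : (((j % n).toNat : ℕ) : ℤ) = j % n := Int.toNat_of_nonneg (Int.emod_nonneg j hn.ne')
    have hlt : (j % n).toNat < n := by
      have := Int.emod_lt_of_pos j hn
      omega
    have h0 := base _ hlt
    rw [hb] at h0
    have hy := hcomm.zpow_right (j / n)
    have hj : j = j % n + n * (j / n) := (Int.emod_add_mul_ediv j n).symm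
    have hj' : j + (m % n : ℕ) = j % n + (m % n : ℕ) + n * (j / n) := by
      rw [add_right_comm, ← hj]
    calc extendX x y j * P
        = y ^ (j / n) * extendX x y (j % n) * ((y ^ (j / n))⁻¹ * P) := by
          conv_lhs => rw [hj, extendX_add, mul_assoc]
      _ = y ^ (j / n) * (extendX x y (j % n) * P) * (y ^ (j / n))⁻¹ := by
          rw [← hy.inv_right.eq]
          simp only [mul_assoc]
      _ = y ^ (j / n) * P * extendX x y (j % n + (m % n : ℕ)) * (y ^ (j / n))⁻¹ := by
          rw [h0]
          simp only [mul_assoc]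
      _ = P * extendX x y (j + (m % n : ℕ)) := by
          rw [← hy.eq, hj', extendX_add]
          simp only [mul_assoc]
  intro j
  rw [all, neg_add_cancel_right]

theorem commute_theta (h : IsBraidFamily m x y z) (hn : 0 < n) :
    Commute y (braidTheta m x y z) :=
  ((h.commute_y (Nat.mod_lt m hn).le).symm).mul_right
    (((Commute.refl y).pow_right _).inv_right)

theorem shifts_theta [NeZero n] (h : IsBraidFamily m x y z) :
    Shifts (extendX x y) (braidTheta m x y z) (-m) := by
  have h1 := h.shifts.mul ((shifts_y x y).zpow (m / n : ℕ)).inv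
  rw [zpow_natCast] at h1
  have hqr : (n : ℤ) * (m / n : ℕ) + (m % n : ℕ) = m := by exact_mod_cast Nat.div_add_mod m n
  rwa [show -((m % n : ℕ) : ℤ) + -(n * (m / n : ℕ)) = -m by linear_combination -hqr] at h1

variable {α β : ℤ}

theorem shifts_braidT [NeZero n] (h : IsBraidFamily m x y z) (hαβ : α * n + β * m = 1) :
    Shifts (extendX x y) (braidT m α β x y z) 1 := by
  have h1 := ((shifts_y x y).zpow α).mul (h.shifts_theta.zpow (-β))
  rwa [show (n : ℤ) * α + -m * -β = 1 by linear_combination hαβ] at h1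

theorem shifts_braidC [NeZero n] (h : IsBraidFamily m x y z) :
    Shifts (extendX x y) (braidC m x y z) 0 := by
  have h1 := ((shifts_y x y).zpow m).mul (h.shifts_theta.zpow n)
  rwa [show (n : ℤ) * m + -m * n = 0 by ring] at h1

theorem commute_braidT_braidC (h : IsBraidFamily m x y z) (hn : 0 < n) :
    Commute (braidT m α β x y z) (braidC m x y z) := by
  have hc := h.commute_theta hn
  rw [Commute, SemiconjBy, braidT, braidC, hc.zpow_mul_zpow_mul, hc.zpow_mul_zpow_mul,
    add_comm α, add_comm (-β)]

theorem commute_braidW_braidC [NeZero n] (h : IsBraidFamily m x y z) :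
    Commute (braidW m α β x y z) (braidC m x y z) := by
  have hn := Nat.pos_of_neZero n
  have h0 := h.shifts_braidC 0
  have hx : extendX x y 0 = x 0 := by
    have := extendX_natCast x y hn
    rwa [Nat.cast_zero] at this
  rw [add_zero, hx] at h0
  exact Commute.mul_left (Commute.symm h0) (h.commute_braidT_braidC hn)

theorem eq_shiftX [NeZero n] (h : IsBraidFamily m x y z) (hαβ : α * n + β * m = 1) :
    x = shiftX n (braidT m α β x y z) (braidW m α β x y z) := by
  have hx : extendX x y 0 = x 0 := by
    have := extendX_natCast x y (Nat.pos_of_neZero n)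
    rwa [Nat.cast_zero] at this
  ext j
  have h1 := (h.shifts_braidT hαβ).eq_conj j
  rw [extendX_natCast x y j.2, hx] at h1
  rw [shiftX, braidW, zpow_add_one, mul_inv_rev]
  simpa [mul_assoc] using h1

theorem eq_y (h : IsBraidFamily m x y z) (hn : 0 < n) (hαβ : α * n + β * m = 1) :
    y = braidT m α β x y z ^ (n : ℤ) * braidC m x y z ^ β := by
  have hc := h.commute_theta hn
  rw [braidT, braidC, hc.zpow_mul_zpow_zpow, hc.zpow_mul_zpow_zpow, hc.zpow_mul_zpow_mul,
    show α * n + m * β = 1 by linear_combination hαβ, show -β * n + n * β = 0 by ring, zpow_one,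
    zpow_zero, mul_one]

theorem braidTheta_eq (h : IsBraidFamily m x y z) (hn : 0 < n) (hαβ : α * n + β * m = 1) :
    braidTheta m x y z = braidT m α β x y z ^ (-(m : ℤ)) * braidC m x y z ^ α := by
  have hc := h.commute_theta hn
  rw [braidT, braidC, hc.zpow_mul_zpow_zpow, hc.zpow_mul_zpow_zpow, hc.zpow_mul_zpow_mul,
    show α * -m + m * α = 0 by ring, show -β * -m + n * α = 1 by linear_combination hαβ,
    zpow_one, zpow_zero, one_mul]

/-- Since `Θ` is `z` times an element depending only on `x` and `y`, it suffices to compare with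
the value of `Θ` for the family built from `T`, `w` and `C`. -/
theorem eq_z [NeZero n] (h : IsBraidFamily m x y z) (hαβ : α * n + β * m = 1) :
    z = braidC m x y z ^ α * braidW m α β x y z ^ (-(m : ℤ)) := by
  have hn := Nat.pos_of_neZero n
  have h1 := braidTheta_shiftX (m := m) (α := α) (β := β) hn
    (h.commute_braidT_braidC (α := α) (β := β) hn) (h.commute_braidW_braidC (α := α) (β := β))
  rw [← h.eq_shiftX hαβ, ← h.eq_y hn hαβ, ← h.braidTheta_eq hn hαβ] at h1
  rw [braidTheta, braidTheta, mul_left_inj, mul_left_inj, mul_left_inj] at h1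
  exact h1.symm

end IsBraidFamily

end BraidFamily

/-! ### Braid groups as circular groups -/

section Presentations

variable {n m : ℕ}

theorem isBraidFamily_map {A G : Type*} [Group G] {f : FreeGroup A →* G} {x : Fin n → FreeGroup A}
    {y z : FreeGroup A} (h : ∀ w ∈ commRelators x y z ∪ shiftRelators m x y z, f w = 1) :
    IsBraidFamily m (fun i => f (x i)) (f y) (f z) := by
  rw [IsBraidFamily, ← image_commRelators, ← image_shiftRelators, ← Set.image_union]
  rintro _ ⟨w, hw, rfl⟩
  exact h w hw

theorem IsBraidFamily.map_eq_one {A G : Type*} [Group G] {f : FreeGroup A →* G}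
    {x : Fin n → FreeGroup A} {y z : FreeGroup A}
    (h : IsBraidFamily m (fun i => f (x i)) (f y) (f z)) :
    ∀ w ∈ commRelators x y z ∪ shiftRelators m x y z, f w = 1 := by
  rw [IsBraidFamily, ← image_commRelators, ← image_shiftRelators, ← Set.image_union] at h
  exact fun w hw => h _ ⟨w, hw, rfl⟩

theorem eq_one_of_mem_commRelators_one {G : Type*} [Group G] {x : Fin n → G} {y w : G}
    (hw : w ∈ commRelators x y 1) : w = 1 := by
  rw [commRelators, Set.mem_singleton_iff] at hw
  simpa using hw

/-- `B_*^*(n, m)` and `G(3, 3)` are both the direct product of the free group on `T, w` and the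
infinite cyclic group generated by `C`. -/
theorem nonempty_braidGroupYZ_mulEquiv (hn : 0 < n) {α β : ℤ} (hαβ : α * n + β * m = 1) :
    Nonempty (BraidGroupYZ n m ≃* CircularGroup 3 3) := by
  have : NeZero n := ⟨hn.ne'⟩
  let bx : Fin n → BraidGroupYZ n m := fun i => PresentedGroup.of (Sum.inl i)
  let bY : BraidGroupYZ n m := PresentedGroup.of (Sum.inr (Sum.inl ()))
  let bZ : BraidGroupYZ n m := PresentedGroup.of (Sum.inr (Sum.inr ()))
  have hB : IsBraidFamily m bx bY bZ :=
    isBraidFamily_map (f := PresentedGroup.mk _) fun w hw => PresentedGroup.one_of_mem hw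
  let T := braidT m α β bx bY bZ
  let w := braidW m α β bx bY bZ
  let C := braidC m bx bY bZ
  have hTC : Commute T C := hB.commute_braidT_braidC hn
  have hwC : Commute w C := hB.commute_braidW_braidC
  -- `G(3, 3)` is generated by `a_0`, `a_1` and the central element `Δ = a_0 a_1 a_2`
  let a : ZMod 3 → CircularGroup 3 3 := CircularGroup.atom 3
  let Δ := CircularGroup.garside 3 3
  have hΔ : ∀ i, Commute (a i) Δ := fun i => by
    have h := CircularGroup.atom_mul_garside (l := 3) i
    have h3 : ∀ i : ZMod 3, i + ((3 : ℕ) : ZMod 3) = i := by decide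
    rwa [h3] at h
  have hF : IsBraidFamily m (shiftX n (a 0) (a 1)) (a 0 ^ (n : ℤ) * Δ ^ β)
      (Δ ^ α * a 1 ^ (-(m : ℤ))) := isBraidFamily_shiftX hn (hΔ 0) (hΔ 1)
  have hcases : ∀ i : ZMod 3, i = 0 ∨ i = 1 ∨ i = 2 := by decide
  let f : Fin n ⊕ Unit ⊕ Unit → CircularGroup 3 3 := Sum.elim (shiftX n (a 0) (a 1))
    (Sum.elim (fun _ => a 0 ^ (n : ℤ) * Δ ^ β) fun _ => Δ ^ α * a 1 ^ (-(m : ℤ)))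
  let Φ : BraidGroupYZ n m →* CircularGroup 3 3 := PresentedGroup.toGroup (f := f)
    (IsBraidFamily.map_eq_one (by simpa [f] using hF))
  have hΦx : (fun i => Φ (bx i)) = shiftX n (a 0) (a 1) :=
    funext fun i => PresentedGroup.toGroup.of _
  have hΦy : Φ bY = a 0 ^ (n : ℤ) * Δ ^ β := PresentedGroup.toGroup.of _
  have hΦz : Φ bZ = Δ ^ α * a 1 ^ (-(m : ℤ)) := PresentedGroup.toGroup.of _
  let Ψ : CircularGroup 3 3 →* BraidGroupYZ n m :=
    CircularGroup.lift (fun i : ZMod 3 => (![T, w, (T * w)⁻¹ * C] : Fin 3 → _) i) (by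
      have h0 : T * (w * ((T * w)⁻¹ * C)) = C := by group
      have h1 : w * ((T * w)⁻¹ * C * T) = C := by
        rw [mul_assoc _ C, ← hTC.eq]
        group
      have h2 : (T * w)⁻¹ * C * (T * w) = C := by
        rw [mul_assoc, ← (hTC.mul_left hwC).eq, inv_mul_cancel_left]
      have e0 : run (0 : ZMod 3) 3 = [0, 1, 2] := by decide
      have e1 : run (1 : ZMod 3) 3 = [1, 2, 0] := by decide
      have e2 : run (2 : ZMod 3) 3 = [2, 0, 1] := by decide
      intro i
      rw [e0]
      rcases hcases i with rfl | rfl | rfl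
      · rw [e0]
      · rw [e1]
        simpa [mul_assoc] using h1.trans h0.symm
      · rw [e2]
        simpa [mul_assoc] using h2.trans h0.symm)
  have hΨ0 : Ψ (a 0) = T := CircularGroup.lift_atom _ _ _
  have hΨ1 : Ψ (a 1) = w := CircularGroup.lift_atom _ _ _
  have hΨ2 : Ψ (a 2) = (T * w)⁻¹ * C := CircularGroup.lift_atom _ _ _
  have hprod : Δ = a 0 * (a 1 * a 2) := by
    have e0 : run (0 : ZMod 3) 3 = [0, 1, 2] := by decide
    simp [Δ, a, CircularGroup.garside, e0]
  have hΨΔ : Ψ Δ = C := by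
    rw [hprod, map_mul, map_mul, hΨ0, hΨ1, hΨ2]
    group
  have hΦT : Φ T = a 0 := by
    rw [map_braidT, hΦx, hΦy, hΦz, braidT_shiftX hn hαβ (hΔ 0) (hΔ 1)]
  have hΦw : Φ w = a 1 := by
    rw [map_braidW, hΦx, hΦy, hΦz, braidW_shiftX hαβ (hΔ 0) (hΔ 1)]
  have hΦC : Φ C = Δ := by
    rw [map_braidC, hΦx, hΦy, hΦz, braidC_shiftX hn hαβ (hΔ 0) (hΔ 1)]
  refine ⟨MonoidHom.toMulEquiv Φ Ψ (PresentedGroup.ext ?_) (PresentedGroup.ext ?_)⟩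
  · rintro (i | ⟨⟩ | ⟨⟩)
    · change Ψ (Φ (bx i)) = bx i
      rw [show Φ (bx i) = _ from congrFun hΦx i, map_shiftX, hΨ0, hΨ1, ← hB.eq_shiftX hαβ]
    · change Ψ (Φ bY) = bY
      rw [hΦy, map_mul, map_zpow, map_zpow, hΨ0, hΨΔ, ← hB.eq_y hn hαβ]
    · change Ψ (Φ bZ) = bZ
      rw [hΦz, map_mul, map_zpow, map_zpow, hΨ1, hΨΔ, ← hB.eq_z hαβ]
  · have h0 : Φ (Ψ (a 0)) = a 0 := by rw [hΨ0, hΦT]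
    have h1 : Φ (Ψ (a 1)) = a 1 := by rw [hΨ1, hΦw]
    have h2 : Φ (Ψ (a 2)) = a 2 := by
      rw [hΨ2, map_mul, map_inv, map_mul, hΦT, hΦw, hΦC, hprod]
      group
    intro i
    change Φ (Ψ (a i)) = a i
    rcases hcases i with rfl | rfl | rfl
    exacts [h0, h1, h2]

theorem prod_run_two {G : Type*} [Group G] (f : ZMod 2 → G) (i : ZMod 2) (N : ℕ) :
    ((run i (2 * N)).map f).prod = (f i * f (i + 1)) ^ N := by
  induction N with
  | zero => simp [run]
  | succ N ih =>
    have h2 : ∀ i : ZMod 2, i + ((2 : ℕ) : ZMod 2) = i := by decide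
    rw [mul_add, mul_one, add_comm, run_add, List.map_append, List.prod_append, h2, ih, pow_succ']
    simp [run]

/-- `G(2, 2N)` is the group `⟨S, v ∣ [S, v ^ N] = 1⟩`, with `S = a_0` and `v = a_0 a_1`. -/
theorem exists_circularGroup_two_hom {G : Type*} [Group G] {N : ℕ} {S v : G}
    (h : Commute S (v ^ N)) : ∃ Ψ : CircularGroup 2 (2 * N) →* G,
      Ψ (CircularGroup.atom _ 0) = S ∧
      Ψ (CircularGroup.atom _ 0 * CircularGroup.atom _ 1) = v := by
  have hcases : ∀ i : ZMod 2, i = 0 ∨ i = 1 := by decide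
  let f : ZMod 2 → G := fun i => (![S, S⁻¹ * v] : Fin 2 → G) i
  have hf : ∀ i, ((run i (2 * N)).map f).prod = ((run 0 (2 * N)).map f).prod := by
    intro i
    rw [prod_run_two, prod_run_two]
    rcases hcases i with rfl | rfl
    · rfl
    · change (S⁻¹ * v * S) ^ N = (S * (S⁻¹ * v)) ^ N
      have hconj := conj_pow (i := N) (a := S⁻¹) (b := v)
      rw [inv_inv] at hconj
      rw [mul_inv_cancel_left, hconj, mul_assoc, ← h.eq, inv_mul_cancel_left]
  refine ⟨CircularGroup.lift f hf, CircularGroup.lift_atom _ _ _, ?_⟩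
  rw [map_mul, CircularGroup.lift_atom, CircularGroup.lift_atom]
  exact mul_inv_cancel_left S v

theorem commute_circularGroup_two (N : ℕ) :
    Commute (CircularGroup.atom (p := 2) (2 * N) 0)
      ((CircularGroup.atom _ 0 * CircularGroup.atom _ 1) ^ N) := by
  have h := CircularGroup.atom_mul_garside (l := 2 * N) (0 : ZMod 2)
  have h2 : ((2 * N : ℕ) : ZMod 2) = 0 := by
    rw [Nat.cast_mul, show ((2 : ℕ) : ZMod 2) = 0 by decide, zero_mul]
  rwa [CircularGroup.garside, prod_run_two, h2, add_zero, zero_add] at h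

theorem circularGroup_two_hom_ext {G : Type*} [Group G] {l : ℕ} {f g : CircularGroup 2 l →* G}
    (h0 : f (CircularGroup.atom _ 0) = g (CircularGroup.atom _ 0))
    (h1 : f (CircularGroup.atom _ 0 * CircularGroup.atom _ 1) =
      g (CircularGroup.atom _ 0 * CircularGroup.atom _ 1)) : f = g := by
  have hcases : ∀ i : ZMod 2, i = 0 ∨ i = 1 := by decide
  refine PresentedGroup.ext fun i => ?_
  rcases hcases i with rfl | rfl
  · exact h0
  · rw [map_mul, map_mul, h0] at h1
    exact mul_left_cancel h1

/-- Erasing `z` amounts to `w ^ m = C ^ α`. As `α` and `m` are coprime, `w` and `C` are then powers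
`v ^ α` and `v ^ m` of `v = w ^ n C ^ β`, and what remains is the presentation
`⟨T, v ∣ [T, v ^ m] = 1⟩` of `G(2, 2m)`. -/
theorem nonempty_braidGroupY_mulEquiv (hn : 0 < n) {α β : ℤ} (hαβ : α * n + β * m = 1) :
    Nonempty (BraidGroupY n m ≃* CircularGroup 2 (2 * m)) := by
  have : NeZero n := ⟨hn.ne'⟩
  let bx : Fin n → BraidGroupY n m := fun i => PresentedGroup.of (Sum.inl i)
  let bY : BraidGroupY n m := PresentedGroup.of (Sum.inr ())
  have hB : IsBraidFamily m bx bY 1 := by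
    have h := isBraidFamily_map (m := m) (f := PresentedGroup.mk (shiftRelators m
      (fun i : Fin n => FreeGroup.of (Sum.inl i)) (FreeGroup.of (Sum.inr ())) 1))
      (x := fun i => FreeGroup.of (Sum.inl i)) (y := FreeGroup.of (Sum.inr ())) (z := 1) (by
        rintro w (hw | hw)
        · rw [eq_one_of_mem_commRelators_one hw, map_one]
        · exact PresentedGroup.one_of_mem hw)
    rw [map_one] at h
    exact h
  let T := braidT m α β bx bY 1
  let w := braidW m α β bx bY 1
  let C := braidC m bx bY 1
  have hTC : Commute T C := hB.commute_braidT_braidC hn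
  have hwC : Commute w C := hB.commute_braidW_braidC
  have hwm : w ^ (m : ℤ) = C ^ α := by
    have h : 1 = C ^ α * w ^ (-(m : ℤ)) := hB.eq_z hαβ
    rw [zpow_neg, eq_mul_inv_iff_mul_eq, one_mul] at h
    exact h
  have hv : ∀ k : ℤ, (w ^ (n : ℤ) * C ^ β) ^ k = w ^ (n * k) * C ^ (β * k) :=
    hwC.zpow_mul_zpow_zpow _ _
  have hvm : (w ^ (n : ℤ) * C ^ β) ^ (m : ℤ) = C := by
    rw [hv, mul_comm (n : ℤ), zpow_mul, hwm, ← zpow_mul, ← zpow_add, hαβ, zpow_one]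
  have hvα : (w ^ (n : ℤ) * C ^ β) ^ α = w := by
    rw [hv, mul_comm β, zpow_mul C, ← hwm, ← zpow_mul, ← zpow_add,
      show n * α + m * β = 1 by linear_combination hαβ, zpow_one]
  let a₀ : CircularGroup 2 (2 * m) := CircularGroup.atom _ 0
  let v : CircularGroup 2 (2 * m) := a₀ * CircularGroup.atom _ 1
  have hac : Commute a₀ (v ^ (m : ℤ)) := by
    rw [zpow_natCast]
    exact commute_circularGroup_two m
  have hvc : Commute (v ^ α) (v ^ (m : ℤ)) := (Commute.refl v).zpow_zpow _ _
  have hz : (v ^ (m : ℤ)) ^ α * (v ^ α) ^ (-(m : ℤ)) = 1 := by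
    rw [← zpow_mul, ← zpow_mul, ← zpow_add, show m * α + α * -m = 0 by ring, zpow_zero]
  have hF : IsBraidFamily m (shiftX n a₀ (v ^ α)) (a₀ ^ (n : ℤ) * (v ^ (m : ℤ)) ^ β) 1 := by
    have h := isBraidFamily_shiftX (m := m) (α := α) (β := β) hn hac hvc
    rwa [hz] at h
  let f : Fin n ⊕ Unit → CircularGroup 2 (2 * m) := Sum.elim (shiftX n a₀ (v ^ α))
    fun _ => a₀ ^ (n : ℤ) * (v ^ (m : ℤ)) ^ β
  let Φ : BraidGroupY n m →* CircularGroup 2 (2 * m) := PresentedGroup.toGroup (f := f)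
    fun r hr => IsBraidFamily.map_eq_one (by simpa [f] using hF) r (Or.inr hr)
  have hΦx : (fun i => Φ (bx i)) = shiftX n a₀ (v ^ α) :=
    funext fun i => PresentedGroup.toGroup.of _
  have hΦy : Φ bY = a₀ ^ (n : ℤ) * (v ^ (m : ℤ)) ^ β := PresentedGroup.toGroup.of _
  obtain ⟨Ψ, hΨ0, hΨv⟩ := exists_circularGroup_two_hom (N := m) (S := T)
    (v := w ^ (n : ℤ) * C ^ β) (by rw [← zpow_natCast, hvm]; exact hTC)
  change Ψ a₀ = T at hΨ0
  change Ψ v = _ at hΨv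
  have hΦT : Φ T = a₀ := by
    rw [map_braidT, hΦx, hΦy, map_one, ← hz, braidT_shiftX hn hαβ hac hvc]
  have hΦw : Φ w = v ^ α := by
    rw [map_braidW, hΦx, hΦy, map_one, ← hz, braidW_shiftX hαβ hac hvc]
  have hΦC : Φ C = v ^ (m : ℤ) := by
    rw [map_braidC, hΦx, hΦy, map_one, ← hz, braidC_shiftX hn hαβ hac hvc]
  refine ⟨MonoidHom.toMulEquiv Φ Ψ (PresentedGroup.ext ?_) (circularGroup_two_hom_ext ?_ ?_)⟩
  · rintro (i | ⟨⟩)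
    · change Ψ (Φ (bx i)) = bx i
      rw [show Φ (bx i) = _ from congrFun hΦx i, map_shiftX, map_zpow, hΨ0, hΨv, hvα,
        ← hB.eq_shiftX hαβ]
    · change Ψ (Φ bY) = bY
      rw [hΦy, map_mul, map_zpow, map_zpow, map_zpow, hΨ0, hΨv, hvm, ← hB.eq_y hn hαβ]
  · change Φ (Ψ a₀) = a₀
    rw [hΨ0, hΦT]
  · change Φ (Ψ v) = v
    rw [hΨv, map_mul, map_zpow, map_zpow, hΦw, hΦC, ← zpow_mul, ← zpow_mul, ← zpow_add,
      show α * n + m * β = 1 by linear_combination hαβ, zpow_one]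

/-- Erasing `y` amounts to `T ^ n = C ^ (-β)`. As `β` and `n` are coprime, `T` and `C` are then
powers `v ^ (-β)` and `v ^ n` of `v = T ^ (-m) C ^ α`, and what remains is the presentation
`⟨w, v ∣ [w, v ^ n] = 1⟩` of `G(2, 2n)`. -/
theorem nonempty_braidGroupZ_mulEquiv (hn : 0 < n) {α β : ℤ} (hαβ : α * n + β * m = 1) :
    Nonempty (BraidGroupZ n m ≃* CircularGroup 2 (2 * n)) := by
  have : NeZero n := ⟨hn.ne'⟩
  let bx : Fin n → BraidGroupZ n m := fun i => PresentedGroup.of (Sum.inl i)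
  let bZ : BraidGroupZ n m := PresentedGroup.of (Sum.inr ())
  have hB : IsBraidFamily m bx 1 bZ := by
    have h := isBraidFamily_map (m := m) (f := PresentedGroup.mk (commRelators
      (fun i : Fin n => FreeGroup.of (Sum.inl i)) 1 (FreeGroup.of (Sum.inr ())) ∪ shiftRelators m
      (fun i : Fin n => FreeGroup.of (Sum.inl i)) 1 (FreeGroup.of (Sum.inr ()))))
      (x := fun i => FreeGroup.of (Sum.inl i)) (y := 1) (z := FreeGroup.of (Sum.inr ()))
      fun w hw => PresentedGroup.one_of_mem hw
    rw [map_one] at h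
    exact h
  let T := braidT m α β bx 1 bZ
  let w := braidW m α β bx 1 bZ
  let C := braidC m bx 1 bZ
  have hTC : Commute T C := hB.commute_braidT_braidC hn
  have hwC : Commute w C := hB.commute_braidW_braidC
  have hTn : T ^ (n : ℤ) = C ^ (-β) := by
    have h : 1 = T ^ (n : ℤ) * C ^ β := hB.eq_y hn hαβ
    rw [zpow_neg]
    exact eq_inv_of_mul_eq_one_left h.symm
  have hv : ∀ k : ℤ, (T ^ (-(m : ℤ)) * C ^ α) ^ k = T ^ (-m * k) * C ^ (α * k) :=
    hTC.zpow_mul_zpow_zpow _ _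
  have hvn : (T ^ (-(m : ℤ)) * C ^ α) ^ (n : ℤ) = C := by
    rw [hv, mul_comm (-(m : ℤ)), zpow_mul, hTn, ← zpow_mul, ← zpow_add,
      show -β * -m + α * n = 1 by linear_combination hαβ, zpow_one]
  have hvβ : (T ^ (-(m : ℤ)) * C ^ α) ^ (-β) = T := by
    rw [hv, mul_comm α, zpow_mul C, ← hTn, ← zpow_mul, ← zpow_add,
      show -m * -β + n * α = 1 by linear_combination hαβ, zpow_one]
  let a₀ : CircularGroup 2 (2 * n) := CircularGroup.atom _ 0
  let v : CircularGroup 2 (2 * n) := a₀ * CircularGroup.atom _ 1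
  have hac : Commute a₀ (v ^ (n : ℤ)) := by
    rw [zpow_natCast]
    exact commute_circularGroup_two n
  have hvc : Commute (v ^ (-β)) (v ^ (n : ℤ)) := (Commute.refl v).zpow_zpow _ _
  have hy : (v ^ (-β)) ^ (n : ℤ) * (v ^ (n : ℤ)) ^ β = 1 := by
    rw [← zpow_mul, ← zpow_mul, ← zpow_add, show -β * n + n * β = 0 by ring, zpow_zero]
  have hF : IsBraidFamily m (shiftX n (v ^ (-β)) a₀) 1
      ((v ^ (n : ℤ)) ^ α * a₀ ^ (-(m : ℤ))) := by
    have h := isBraidFamily_shiftX (m := m) (α := α) (β := β) hn hvc hac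
    rwa [hy] at h
  let f : Fin n ⊕ Unit → CircularGroup 2 (2 * n) := Sum.elim (shiftX n (v ^ (-β)) a₀)
    fun _ => (v ^ (n : ℤ)) ^ α * a₀ ^ (-(m : ℤ))
  let Φ : BraidGroupZ n m →* CircularGroup 2 (2 * n) := PresentedGroup.toGroup (f := f)
    (IsBraidFamily.map_eq_one (by
      rw [map_one]
      simp only [FreeGroup.lift_apply_of]
      exact hF))
  have hΦx : (fun i => Φ (bx i)) = shiftX n (v ^ (-β)) a₀ :=
    funext fun i => PresentedGroup.toGroup.of _
  have hΦz : Φ bZ = (v ^ (n : ℤ)) ^ α * a₀ ^ (-(m : ℤ)) := PresentedGroup.toGroup.of _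
  obtain ⟨Ψ, hΨ0, hΨv⟩ := exists_circularGroup_two_hom (N := n) (S := w)
    (v := T ^ (-(m : ℤ)) * C ^ α) (by rw [← zpow_natCast, hvn]; exact hwC)
  change Ψ a₀ = w at hΨ0
  change Ψ v = _ at hΨv
  have hΦT : Φ T = v ^ (-β) := by
    rw [map_braidT, hΦx, hΦz, map_one, ← hy, braidT_shiftX hn hαβ hvc hac]
  have hΦw : Φ w = a₀ := by
    rw [map_braidW, hΦx, hΦz, map_one, ← hy, braidW_shiftX hαβ hvc hac]
  have hΦC : Φ C = v ^ (n : ℤ) := by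
    rw [map_braidC, hΦx, hΦz, map_one, ← hy, braidC_shiftX hn hαβ hvc hac]
  refine ⟨MonoidHom.toMulEquiv Φ Ψ (PresentedGroup.ext ?_) (circularGroup_two_hom_ext ?_ ?_)⟩
  · rintro (i | ⟨⟩)
    · change Ψ (Φ (bx i)) = bx i
      rw [show Φ (bx i) = _ from congrFun hΦx i, map_shiftX, map_zpow, hΨ0, hΨv, hvβ,
        ← hB.eq_shiftX hαβ]
    · change Ψ (Φ bZ) = bZ
      rw [hΦz, map_mul, map_zpow, map_zpow, map_zpow, hΨ0, hΨv, hvn, ← hB.eq_z hαβ]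
  · change Φ (Ψ a₀) = a₀
    rw [hΨ0, hΦw]
  · change Φ (Ψ v) = v
    rw [hΨv, map_mul, map_zpow, map_zpow, hΦT, hΦC, ← zpow_mul, ← zpow_mul, ← zpow_add,
      show -β * -m + n * α = 1 by linear_combination hαβ, zpow_one]

/-- The presentations of `B(n, m)` and `G(n, m)` differ only in which pairs of words are
equated. -/
theorem nonempty_braidGroupToric_mulEquiv (hn : 0 < n) :
    Nonempty (BraidGroupToric n m ≃* CircularGroup n m) := by
  have : NeZero n := ⟨hn.ne'⟩
  have htoric : ∀ i j : ZMod n, (PresentedGroup.mk _ (cyclicWord n m i) : BraidGroupToric n m) =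
      PresentedGroup.mk _ (cyclicWord n m j) := by
    have hlt : ∀ i j : ℕ, 1 ≤ i → i < j → j ≤ n →
        (PresentedGroup.mk _ (cyclicWord n m i) : BraidGroupToric n m) =
        PresentedGroup.mk _ (cyclicWord n m j) := fun i j h1 h2 h3 => by
      rw [← mul_inv_eq_one, ← map_inv, ← map_mul]
      exact PresentedGroup.one_of_mem ⟨i, j, h1, h2, h3, rfl⟩
    have hrep : ∀ i : ZMod n, ∃ k : ℕ, 1 ≤ k ∧ k ≤ n ∧ i = k := fun i => by
      by_cases hi : i = 0
      · exact ⟨n, hn, le_rfl, by simp [hi]⟩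
      · refine ⟨i.val, Nat.pos_of_ne_zero ?_, (ZMod.val_lt i).le, (ZMod.natCast_zmod_val i).symm⟩
        rwa [Ne, ZMod.val_eq_zero]
    intro i j
    obtain ⟨i, hi1, hin, rfl⟩ := hrep i
    obtain ⟨j, hj1, hjn, rfl⟩ := hrep j
    rcases lt_trichotomy i j with h | rfl | h
    · exact hlt i j hi1 h hjn
    · rfl
    · exact (hlt j i hj1 h hin).symm
  have hcirc : ∀ i j : ZMod n, (PresentedGroup.mk _ (cyclicWord n m i) : CircularGroup n m) =
      PresentedGroup.mk _ (cyclicWord n m j) := by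
    have h0 : ∀ i : ZMod n, (PresentedGroup.mk _ (cyclicWord n m 0) : CircularGroup n m) =
        PresentedGroup.mk _ (cyclicWord n m i) := fun i => by
      rw [← mul_inv_eq_one, ← map_inv, ← map_mul]
      exact PresentedGroup.one_of_mem ⟨i, rfl⟩
    exact fun i j => (h0 i).symm.trans (h0 j)
  have hmk : ∀ {rels : Set (FreeGroup (ZMod n))} (w : FreeGroup (ZMod n)),
      FreeGroup.lift (fun i => (PresentedGroup.of i : PresentedGroup rels)) w =
        PresentedGroup.mk rels w := fun {rels} w =>
    DFunLike.congr_fun (FreeGroup.ext_hom _ (PresentedGroup.mk rels)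
      fun i => by simp [PresentedGroup.of]) w
  let Φ : BraidGroupToric n m →* CircularGroup n m := PresentedGroup.toGroup
    (f := PresentedGroup.of) (by
      rintro _ ⟨i, j, -, -, -, rfl⟩
      rw [map_mul, map_inv, hmk, hmk, hcirc i j, mul_inv_cancel])
  let Ψ : CircularGroup n m →* BraidGroupToric n m := PresentedGroup.toGroup
    (f := PresentedGroup.of) (by
      rintro _ ⟨i, rfl⟩
      rw [map_mul, map_inv, hmk, hmk, htoric 0 i, mul_inv_cancel])
  refine ⟨MonoidHom.toMulEquiv Φ Ψ (PresentedGroup.ext fun i => ?_)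
    (PresentedGroup.ext fun i => ?_)⟩ <;> simp [Φ, Ψ]

end Presentations

theorem IsCircularGroup.isGarsideGroup {G : Type} [Group G] (h : IsCircularGroup G) :
    IsGarsideGroup G := by
  obtain ⟨p, l, hp, hl, ⟨e⟩⟩ := h
  exact (CircularGroup.isGarsideGroup hp hl).of_mulEquiv e

theorem IsCircularGroup.eq_one_of_isOfFinOrder {G : Type*} [Group G] (h : IsCircularGroup G)
    (g : G) (hg : IsOfFinOrder g) : g = 1 := by
  obtain ⟨p, l, -, hl, ⟨e⟩⟩ := h
  have h1 := CircularGroup.eq_one_of_isOfFinOrder hl (e g) (e.toMonoidHom.isOfFinOrder hg)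
  exact (map_eq_one_iff e e.injective).1 h1

theorem JReflectionGroup.isCircularGroup_braidGroup (W : JReflectionGroup) :
    IsCircularGroup W.braidGroup := by
  have hn : 0 < W.n := Nat.pos_of_ne_zero fun h => by simpa [h] using W.two_le_bn
  have hm : 0 < W.m := Nat.pos_of_ne_zero fun h => by simpa [h] using W.two_le_cm
  obtain ⟨α, β, hαβ⟩ : ∃ α β : ℤ, α * W.n + β * W.m = 1 :=
    Nat.isCoprime_iff_coprime.2 W.coprime
  by_cases hb : W.b = 1 <;> by_cases hc : W.c = 1
  · rw [show W.braidGroup = GrpCat.of (BraidGroupToric W.n W.m) by simp [braidGroup, hb, hc]]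
    exact ⟨W.n, W.m, hn, hm, nonempty_braidGroupToric_mulEquiv hn⟩
  · rw [show W.braidGroup = GrpCat.of (BraidGroupZ W.n W.m) by simp [braidGroup, hb, hc]]
    exact ⟨2, 2 * W.n, one_le_two, by omega, nonempty_braidGroupZ_mulEquiv hn hαβ⟩
  · rw [show W.braidGroup = GrpCat.of (BraidGroupY W.n W.m) by simp [braidGroup, hb, hc]]
    exact ⟨2, 2 * W.m, one_le_two, by omega, nonempty_braidGroupY_mulEquiv hn hαβ⟩
  · rw [show W.braidGroup = GrpCat.of (BraidGroupYZ W.n W.m) by simp [braidGroup, hb, hc]]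
    exact ⟨3, 3, by norm_num, by norm_num, nonempty_braidGroupYZ_mulEquiv hn hαβ⟩

theorem corollary3p29 (W : JReflectionGroup) :
    IsCircularGroup W.braidGroup ∧ IsGarsideGroup W.braidGroup ∧
      ∀ g : W.braidGroup, IsOfFinOrder g → g = 1 := by
  have h := W.isCircularGroup_braidGroup
  exact ⟨h, h.isGarsideGroup, h.eq_one_of_isOfFinOrder⟩
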